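/- All sets lie in the Euclidean plane $\mathbb{R}^2$ and $\dim$ denotes Hausdorff dimension. A triangular cap of height $h>0$ on a segment (its base) is the (full, closed) isosceles triangle with that base and vertical height $h$; its two equal sides are called its shorter sides. Construction. Let $A_{0,1}$ be a segment of positive finite length and $T_{0,1}$ a triangular cap on it. Given $2^n$ caps $T_{n,1},\dots,T_{n,2^n}$ of level $n$, with bases $A_{n,1},\dots,A_{n,2^n}$, let $A_{n+1,1},\dots,A_{n+1,2^{n+1}}$ be their $2^{n+1}$ shorter sides, and let $T_{n+1,j}$ be a triangular cap on $A_{n+1,j}$ lying inside the cap of level $n$ of which $A_{n+1,j}$ is a side. Put $\tilde A_n=\bigcup_{i=1}^{2^n}A_{n,i}$, and let $E$ be the set of all vertices of all caps $T_{n,i}$. A set $A$ is an $A_\varepsilon$-type set with base angles $(\theta_n)_{n\ge 0}$ if there is such a construction in which $T_{0,1}$ has height $\varepsilon$ times the length of $A_{0,1}$ for some $0<\varepsilon<1/100$, in which all caps of level $n$ have base angle $\theta_n$ with $\theta_{n+1}\le\theta_n$ for all $n$, and $A\in\{B,\ B\setminus E\}$, where $B$ is either $\bigcap_{n\ge 0}\bigcup_{i=1}^{2^n}T_{n,i}$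 or $\overline{\bigcup_{n\ge 0}\tilde A_n}\setminus\bigcup_{n\ge 0}\tilde A_n$. For $r\ge 0$ let $A^r$ be the collection of all $A_\varepsilon$-type sets whose base angles satisfy $\lim_{n\to\infty}\theta_n=r$. Theorem. (a) For every $r\ge 0$ and every $A\in A^r$, $$\dim A=-\frac{\ln 2}{\ln\left(\frac12\,(1+\tan^2 r)^{1/2}\right)}.$$ (b) For $0<\varepsilon<1/8$ let $A_\varepsilon=\overline{\bigcup_{n\ge 1}\tilde A_n}\setminus\bigcup_{n\ge 1}\tilde A_n$, where $\tilde A_n$ comes from the construction with base $A_{0,1}=[(0,0),(1,0)]$, with $T_{0,1}$ in the upper half plane, and with all caps of level $n$ of height $2^{1-n}\varepsilon$. Then $\dim A_\varepsilon=1$. -/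

import Mathlib

open scoped EuclideanGeometry

/-! The Euclidean plane is `ℂ`, with its usual distance `‖z - w‖`. -/

/-- The apex of the triangular cap of vertical height `h` on the base `[a, b]`: the point at
distance `h` from the midpoint of the base, perpendicularly to the base, on the left hand side of
the oriented line from `a` to `b`. -/
noncomputable def capApex (h : ℝ) (a b : ℂ) : ℂ :=
  (a + b) / 2 + ((h / ‖b - a‖ : ℝ) : ℂ) * (Complex.I * (b - a))

/-- The triangular cap (a full closed triangle) of vertical height `h` on the base `[a, b]`. -/
def cap (h : ℝ) (a b : ℂ) : Set ℂ := convexHull ℝ {a, b, capApex h a b}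

/-- The base angle of the triangular cap of vertical height `h` on the base `[a, b]`: the angle of
the triangle at `a` (the triangle is isosceles, so the angle at `b` is the same). -/
noncomputable def capBaseAngle (h : ℝ) (a b : ℂ) : ℝ := ∠ (capApex h a b) a b

/-- `capBase h a b n i`, for `i < 2 ^ n`, are the end points of the base of the `i`-th cap of
level `n`, in the construction that starts from the base `[a, b]` and uses caps of vertical height
`h n` at level `n`. The bases of level `n + 1` are the two shorter sides of the caps of
level `n`; they are oriented so that the new cap is built towards the inside of the old one
(see `cap_subset_left` and `cap_subset_right`). -/
noncomputable def capBase (h : ℕ → ℝ) (a b : ℂ) : ℕ → ℕ → ℂ × ℂ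
  | 0, _ => (a, b)
  | n + 1, i =>
    let s := capBase h a b n (i / 2)
    let p := capApex (h n) s.1 s.2
    if i % 2 = 0 then (p, s.1) else (s.2, p)

/-- The `i`-th triangular cap `T_{n,i}` of level `n`. -/
noncomputable def kochCap (h : ℕ → ℝ) (a b : ℂ) (n i : ℕ) : Set ℂ :=
  cap (h n) (capBase h a b n i).1 (capBase h a b n i).2

/-- The base angle of the `i`-th triangular cap of level `n`. -/
noncomputable def kochAngle (h : ℕ → ℝ) (a b : ℂ) (n i : ℕ) : ℝ :=
  capBaseAngle (h n) (capBase h a b n i).1 (capBase h a b n i).2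

/-- The union `⋃ᵢ T_{n,i}` of the `2 ^ n` triangular caps of level `n`. -/
def kochStage (h : ℕ → ℝ) (a b : ℂ) (n : ℕ) : Set ℂ :=
  ⋃ i : Fin (2 ^ n), kochCap h a b n i

/-- The polygonal line `⋃ᵢ A_{n,i}` formed by the `2 ^ n` bases of level `n`. -/
def kochPolygon (h : ℕ → ℝ) (a b : ℂ) (n : ℕ) : Set ℂ :=
  ⋃ i : Fin (2 ^ n), segment ℝ (capBase h a b n i).1 (capBase h a b n i).2

/-- The edge points: all the vertices of all the caps of the construction. -/
def kochEdgePoints (h : ℕ → ℝ) (a b : ℂ) : Set ℂ :=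
  ⋃ n : ℕ, ⋃ i : Fin (2 ^ n), {(capBase h a b n i).1, (capBase h a b n i).2,
    capApex (h n) (capBase h a b n i).1 (capBase h a b n i).2}

/-- The limit set `⋂ₙ ⋃ᵢ T_{n,i}` of the construction through caps. -/
def kochCapLimit (h : ℕ → ℝ) (a b : ℂ) : Set ℂ := ⋂ n : ℕ, kochStage h a b n

/-- The limit set of the construction through polygonal lines: the closure of the union of all
the polygonal lines, with the polygonal lines themselves removed. -/
def kochPolygonLimit (h : ℕ → ℝ) (a b : ℂ) : Set ℂ :=
  closure (⋃ n : ℕ, kochPolygon h a b n) \ ⋃ n : ℕ, kochPolygon h a b n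

/-- The conditions on the construction of a set of type `A_ε`: the first base is a nondegenerate
segment, the caps are nondegenerate triangles, the first one has vertical height `ε` times the
length of its base with `ε < 1 / 100`, all the caps of level `n` have the same base
angle `θ n`, and the base angles do not increase with the level. -/
structure IsAEpsConstruction (h : ℕ → ℝ) (a b : ℂ) (θ : ℕ → ℝ) : Prop where
  base_ne : a ≠ b
  height_pos : ∀ n, 0 < h n
  height_zero : ∃ ε : ℝ, ε < 1 / 100 ∧ h 0 = ε * ‖b - a‖
  angle_eq : ∀ n, ∀ i < 2 ^ n, kochAngle h a b n i = θ n
  angle_le : ∀ n, θ (n + 1) ≤ θ n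

/-- `IsAEpsTypeSet A θ`: the set `A` is an `A_ε`-type set with base angles `θ`, that is, a limit set
(in either of the two forms) of a construction with base angles `θ`, with or without the edge
points. -/
def IsAEpsTypeSet (A : Set ℂ) (θ : ℕ → ℝ) : Prop :=
  ∃ (h : ℕ → ℝ) (a b : ℂ), IsAEpsConstruction h a b θ ∧
    ∃ B : Set ℂ, (B = kochCapLimit h a b ∨ B = kochPolygonLimit h a b) ∧
      (A = B ∨ A = B \ kochEdgePoints h a b)

/-- The collection `A^r` of the `A_ε`-type sets whose base angles decrease to `r`. -/
def AEpsTypeSets (r : ℝ) : Set (Set ℂ) :=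
  {A | ∃ θ : ℕ → ℝ, IsAEpsTypeSet A θ ∧ Filter.Tendsto θ Filter.atTop (nhds r)}

/-- The set `A_ε`: the construction starts from the base `[(0,0), (1,0)]`, the caps of level `n`
have vertical height `2 ^ (1 - n) * ε`, and the polygonal lines `A_n`, `n ≥ 1`, are removed from the
closure of their union. -/
def setAEps (ε : ℝ) : Set ℂ :=
  closure (⋃ n : ℕ, kochPolygon (fun k => (2 : ℝ) ^ (1 - (k : ℤ)) * ε) 0 1 (n + 1)) \
    ⋃ n : ℕ, kochPolygon (fun k => (2 : ℝ) ^ (1 - (k : ℤ)) * ε) 0 1 (n + 1)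

/-- The apex lies on the perpendicular bisector of the base. -/
theorem capApex_perp (h : ℝ) (a b : ℂ) : inner ℝ (capApex h a b - (a + b) / 2) (b - a) = 0 := by
  simp only [capApex, add_sub_cancel_left, Complex.inner]
  simp
  ring

/-- The apex has distance `h` from the midpoint of the base. -/
theorem capApex_dist {h : ℝ} (hh : 0 ≤ h) {a b : ℂ} (hab : a ≠ b) :
    ‖capApex h a b - (a + b) / 2‖ = h := by
  have : ‖b - a‖ ≠ 0 := norm_ne_zero_iff.2 (sub_ne_zero.2 hab.symm)
  simp only [capApex, add_sub_cancel_left, norm_mul, Complex.norm_I, one_mul, Complex.norm_real,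
    Real.norm_eq_abs, abs_div, abs_norm, abs_of_nonneg hh]
  field_simp

theorem mem_cap_of_combo {h x y z : ℝ} {a b q : ℂ} (hx : 0 ≤ x) (hy : 0 ≤ y) (hz : 0 ≤ z)
    (hs : x + y + z = 1) (hq : q = x * a + y * b + z * capApex h a b) : q ∈ cap h a b := by
  have hc : Convex ℝ (cap h a b) := convex_convexHull ℝ _
  have key := hc.sum_mem (t := Finset.univ) (w := ![x, y, z]) (z := ![a, b, capApex h a b])
    (by intro i _; fin_cases i <;> simpa) (by simpa [Fin.sum_univ_three] using hs)
    (by intro i _; fin_cases i <;> exact subset_convexHull ℝ _ (by simp))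
  rw [hq]
  simpa [Fin.sum_univ_three, Complex.real_smul] using key

theorem cap_subset_of_apex_mem {h h' : ℝ} {a b c d : ℂ} (hc : c ∈ cap h a b) (hd : d ∈ cap h a b)
    (hp : capApex h' c d ∈ cap h a b) : cap h' c d ⊆ cap h a b := by
  refine convexHull_min ?_ (convex_convexHull ℝ _)
  rintro z (rfl | rfl | rfl) <;> assumption

/-- A cap on the first shorter side of a cap whose height is at most a quarter of its base, with at
most the same ratio of height to base length (equivalently, with at most the same base angle), is
contained in the old cap. -/
theorem cap_subset_left {h h' : ℝ} {a b : ℂ} (hab : a ≠ b) (hh : 0 < h) (hh' : 0 ≤ h')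
    (hq : h / ‖b - a‖ ≤ 1 / 4) (hr : h' / ‖a - capApex h a b‖ ≤ h / ‖b - a‖) :
    cap h' (capApex h a b) a ⊆ cap h a b := by
  have hn : 0 < ‖b - a‖ := norm_pos_iff.2 (sub_ne_zero.2 hab.symm)
  have hI : Complex.I * Complex.I = -1 := Complex.I_mul_I
  have ht : 0 < h / ‖b - a‖ := div_pos hh hn
  have hs : 0 ≤ h' / ‖a - capApex h a b‖ := div_nonneg hh' (norm_nonneg _)
  refine cap_subset_of_apex_mem (subset_convexHull ℝ _ (by simp))
    (subset_convexHull ℝ _ (by simp)) ?_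
  set s := h' / ‖a - capApex h a b‖ with hsdef
  set t := h / ‖b - a‖ with htdef
  have hst : s / t ≤ 1 := (div_le_one ht).2 hr
  have hst0 : 0 ≤ s / t := div_nonneg hs ht.le
  refine mem_cap_of_combo (x := 1 / 2 + s / t / 4 - s * t) (y := s / t / 4 + s * t)
    (z := (1 - s / t) / 2) ?_ (by positivity) (by linarith) (by ring) ?_
  · nlinarith [mul_le_mul hr hq ht.le ht.le, mul_le_mul_of_nonneg_right hr ht.le]
  · have htc : (t : ℂ) ≠ 0 := by exact_mod_cast ht.ne'
    rw [capApex, ← hsdef, capApex, ← htdef]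
    push_cast
    field_simp
    ring_nf
    simp only [Complex.I_sq]
    ring

/-- A cap on the second shorter side of a cap whose height is at most a quarter of its base, with at
most the same ratio of height to base length (equivalently, with at most the same base angle), is
contained in the old cap. -/
theorem cap_subset_right {h h' : ℝ} {a b : ℂ} (hab : a ≠ b) (hh : 0 < h) (hh' : 0 ≤ h')
    (hq : h / ‖b - a‖ ≤ 1 / 4) (hr : h' / ‖capApex h a b - b‖ ≤ h / ‖b - a‖) :
    cap h' b (capApex h a b) ⊆ cap h a b := by
  have hn : 0 < ‖b - a‖ := norm_pos_iff.2 (sub_ne_zero.2 hab.symm)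
  have hI : Complex.I * Complex.I = -1 := Complex.I_mul_I
  have ht : 0 < h / ‖b - a‖ := div_pos hh hn
  have hs : 0 ≤ h' / ‖capApex h a b - b‖ := div_nonneg hh' (norm_nonneg _)
  refine cap_subset_of_apex_mem (subset_convexHull ℝ _ (by simp))
    (subset_convexHull ℝ _ (by simp)) ?_
  set s := h' / ‖capApex h a b - b‖ with hsdef
  set t := h / ‖b - a‖ with htdef
  have hst : s / t ≤ 1 := (div_le_one ht).2 hr
  have hst0 : 0 ≤ s / t := div_nonneg hs ht.le
  refine mem_cap_of_combo (x := s / t / 4 + s * t) (y := 1 / 2 + s / t / 4 - s * t)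
    (z := (1 - s / t) / 2) (by positivity) ?_ (by linarith) (by ring) ?_
  · nlinarith [mul_le_mul hr hq ht.le ht.le, mul_le_mul_of_nonneg_right hr ht.le]
  · have htc : (t : ℂ) ≠ 0 := by exact_mod_cast ht.ne'
    rw [capApex, ← hsdef, capApex, ← htdef]
    push_cast
    field_simp
    ring_nf
    simp only [Complex.I_sq]
    ring

/-!
All bases of one level have the same length, and the ratio of the lengths of consecutive levels is
`sideRatio (t n) = √(1 + 4 t_n²) / 2 = √(1 + tan² θ_n) / 2`, where `t_n` is the ratio of height to
base length of the caps of level `n`. This ratio decreases to a limit `s`, and the dimension is the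
number `d` with `s ^ d = 1 / 2`. Both parts of the theorem are instances of
`dimH_eq_of_subset_of_subset`, which only needs `t` to be positive, antitone and at most `1 / 4`; in
the second part `t_n` tends to `0`, so that `s = 1 / 2`.

The upper bound (`dimH_le_of_subset_tiles`) comes from the covers by the `2 ^ n` caps of level `n`.

For the lower bound, the caps of level `n` are enumerated along the curve (`curveTile`). Caps that
are not neighbours in this order have a distance comparable to their size
(`le_dist_of_not_neighbours`): two sibling caps leave their common vertex in two cones with an angle
bounded away from zero between them, a property inherited by all pairs of neighbours
(`dist_neighbours`), and a cap on one shorter side stays away from the other end of the base. Choose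
a point `γ x` in the caps whose dyadic intervals contain `x`. Then close points `γ x`, `γ y` have
close parameters, and since no ratio of lengths is below `s`, the inverse of `γ` is Hölder
continuous with exponent `d` (`exists_abs_sub_le_rpow`). So the image under `γ` of a set of
parameters of dimension `1` has dimension at least `d`.

This is applied to the parameters of the points that lie on none of the polygonal lines, all of
which belong to each of the limit sets. They are almost all parameters: if the base angles are
constant, the limit set may meet a base in uncountably many points, but of the four grandchildren of
a cap only two can meet its base in points that are not vertices, and these do so in points of their
own bases (`baseParams_subset`). Hence the exceptional parameters are covered by `2 ^ m` of the
`4 ^ m` dyadic intervals that are `2 * m` levels below.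
-/

/-! ### Triangles with a signed slope -/

/-- The apex of the isosceles triangle on the base `[a, b]` whose ratio of height to base length is
`|u|`; it lies to the left of the line from `a` to `b` if `u > 0` and to the right if `u < 0`. -/
noncomputable def slopeApex (u : ℝ) (a b : ℂ) : ℂ := (a + b) / 2 + (u : ℂ) * (Complex.I * (b - a))

/-- The full closed isosceles triangle on the base `[a, b]` with signed ratio `u` of height to base
length. -/
def slopeTriangle (u : ℝ) (a b : ℂ) : Set ℂ := convexHull ℝ {a, b, slopeApex u a b}

theorem slopeApex_swap (u : ℝ) (a b : ℂ) : slopeApex (-u) b a = slopeApex u a b := by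
  simp only [slopeApex]; push_cast; ring

theorem slopeTriangle_swap (u : ℝ) (a b : ℂ) : slopeTriangle (-u) b a = slopeTriangle u a b := by
  rw [slopeTriangle, slopeApex_swap, slopeTriangle, Set.insert_comm]

theorem mem_slopeTriangle_iff {u : ℝ} {a b z : ℂ} : z ∈ slopeTriangle u a b ↔
    ∃ x y w : ℝ, 0 ≤ x ∧ 0 ≤ y ∧ 0 ≤ w ∧ x + y + w = 1 ∧
      z = x * a + y * b + w * slopeApex u a b := by
  constructor
  · intro hz
    refine convexHull_min (t := {z : ℂ | ∃ x y w : ℝ, 0 ≤ x ∧ 0 ≤ y ∧ 0 ≤ w ∧ x + y + w = 1 ∧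
      z = x * a + y * b + w * slopeApex u a b}) ?_ ?_ hz
    · rintro z (rfl | rfl | rfl)
      · exact ⟨1, 0, 0, by norm_num, le_rfl, le_rfl, by norm_num, by simp⟩
      · exact ⟨0, 1, 0, le_rfl, by norm_num, le_rfl, by norm_num, by simp⟩
      · exact ⟨0, 0, 1, le_rfl, le_rfl, by norm_num, by norm_num, by simp⟩
    · rintro _ ⟨x, y, w, hx, hy, hw, h1, rfl⟩ _ ⟨x', y', w', hx', hy', hw', h1', rfl⟩ α β hα hβ hαβ
      refine ⟨α * x + β * x', α * y + β * y', α * w + β * w', by positivity, by positivity,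
        by positivity, by linear_combination α * h1 + β * h1' + hαβ, ?_⟩
      simp only [Complex.real_smul]; push_cast; ring
  · rintro ⟨x, y, w, hx, hy, hw, h1, rfl⟩
    have hc : Convex ℝ (slopeTriangle u a b) := convex_convexHull ℝ _
    have key := hc.sum_mem (t := Finset.univ) (w := ![x, y, w]) (z := ![a, b, slopeApex u a b])
      (by intro i _; fin_cases i <;> simpa) (by simpa [Fin.sum_univ_three] using h1)
      (by intro i _; fin_cases i <;> exact subset_convexHull ℝ _ (by simp))
    simpa [Fin.sum_univ_three, Complex.real_smul] using key

theorem left_mem_slopeTriangle (u : ℝ) (a b : ℂ) : a ∈ slopeTriangle u a b :=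
  subset_convexHull ℝ _ (by simp)

theorem right_mem_slopeTriangle (u : ℝ) (a b : ℂ) : b ∈ slopeTriangle u a b :=
  subset_convexHull ℝ _ (by simp)

theorem slopeApex_mem_slopeTriangle (u : ℝ) (a b : ℂ) : slopeApex u a b ∈ slopeTriangle u a b :=
  subset_convexHull ℝ _ (by simp)

theorem isCompact_slopeTriangle (u : ℝ) (a b : ℂ) : IsCompact (slopeTriangle u a b) :=
  (Set.toFinite _).isCompact_convexHull (𝕜 := ℝ)

theorem segment_subset_slopeTriangle (u : ℝ) (a b : ℂ) : segment ℝ a b ⊆ slopeTriangle u a b :=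
  (convex_convexHull ℝ _).segment_subset (left_mem_slopeTriangle u a b)
    (right_mem_slopeTriangle u a b)

/-- The triangle on the first shorter side, on the inner side and at most as steep, is contained in
the old triangle. -/
theorem slopeTriangle_subset_left {u r : ℝ} (hu : |u| ≤ 1 / 4) (hr : 0 ≤ r) (hr1 : r ≤ 1)
    (a b : ℂ) : slopeTriangle (-(r * u)) a (slopeApex u a b) ⊆ slopeTriangle u a b := by
  refine convexHull_min ?_ (convex_convexHull ℝ _)
  rintro z (rfl | rfl | rfl)
  · exact left_mem_slopeTriangle _ _ _
  · exact slopeApex_mem_slopeTriangle _ _ _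
  · have h2 : u ^ 2 ≤ 1 / 16 := by rw [← sq_abs]; nlinarith [abs_nonneg u]
    refine mem_slopeTriangle_iff.2 ⟨1 / 2 + r / 4 - r * u ^ 2, r / 4 + r * u ^ 2, (1 - r) / 2,
      by nlinarith, by positivity, by linarith, by ring, ?_⟩
    simp only [slopeApex]; push_cast; ring_nf; simp only [Complex.I_sq]; ring

theorem slopeTriangle_subset_right {u r : ℝ} (hu : |u| ≤ 1 / 4) (hr : 0 ≤ r) (hr1 : r ≤ 1)
    (a b : ℂ) : slopeTriangle (-(r * u)) (slopeApex u a b) b ⊆ slopeTriangle u a b := by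
  have := slopeTriangle_subset_left (u := -u) (by rwa [abs_neg]) hr hr1 b a
  rwa [slopeApex_swap, slopeTriangle_swap, slopeTriangle_swap u, mul_neg] at this

/-- Seen from the apex of a triangle on the base `[a, b]`, the triangle on the shorter side at `a`
lies in a cone around the direction of `a - b`, here written in the coordinate in which
`b - a` is the unit. -/
theorem exists_sub_slopeApex_eq {u v : ℝ} (hu : |u| ≤ 1 / 4) (hv : |v| ≤ 1 / 4) {a b z : ℂ}
    (hz : z ∈ slopeTriangle v a (slopeApex u a b)) :
    ∃ ω : ℂ, z - slopeApex u a b = (b - a) * ω ∧ ω.re ≤ 0 ∧ ‖ω‖ ≤ 5 / 3 * -ω.re := by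
  obtain ⟨x, y, w, hx, hy, hw, h1, rfl⟩ := mem_slopeTriangle_iff.1 hz
  rw [abs_le] at hu hv
  obtain ⟨hu1, hu2⟩ := hu
  obtain ⟨hv1, hv2⟩ := hv
  have huv : -(1 / 16) ≤ u * v := by nlinarith
  have hwv : -(w / 16) ≤ w * (u * v) := by nlinarith
  have hre : x / 2 + w * 3 / 16 ≤ x / 2 + w * (1 / 4 + u * v) := by nlinarith
  have hxu : |x * u| ≤ x / 4 := by rw [abs_le]; constructor <;> nlinarith
  have hwu : |w * (v - u)| ≤ w / 2 := by rw [abs_le]; constructor <;> nlinarith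
  rw [abs_le] at hxu hwu
  refine ⟨⟨-(x / 2 + w * (1 / 4 + u * v)), -(x * u) + w * (v - u) / 2⟩, ?_, ?_, ?_⟩
  · have hy' : y = 1 - x - w := by linarith
    subst hy'
    rw [Complex.mk_eq_add_mul_I]
    simp only [slopeApex]; push_cast; ring_nf; simp only [Complex.I_sq]; ring
  · simp only; nlinarith
  · simp only [neg_neg]
    rw [Complex.norm_def]
    refine Real.sqrt_le_iff.2 ⟨by nlinarith, ?_⟩
    rw [Complex.normSq_mk]
    -- the imaginary part is at most `4 / 3` times the real part
    have him : |-(x * u) + w * (v - u) / 2| ≤ 4 / 3 * (x / 2 + w * (1 / 4 + u * v)) := by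
      rw [abs_le]; constructor <;> linarith
    have := mul_self_le_mul_self (abs_nonneg _) him
    rw [abs_mul_abs_self] at this
    nlinarith

/-- The triangles on the two shorter sides lie in two cones at the apex, with an angle bounded away
from zero between them, so that the distance of two points of them is at least comparable to their
distances to the apex. -/
theorem dist_siblings {u v : ℝ} (hu : |u| ≤ 1 / 4) (hv : |v| ≤ 1 / 4) {a b z z' : ℂ}
    (hz : z ∈ slopeTriangle v a (slopeApex u a b)) (hz' : z' ∈ slopeTriangle v (slopeApex u a b) b) :
    3 / 5 * (‖z - slopeApex u a b‖ + ‖z' - slopeApex u a b‖) ≤ ‖z - z'‖ := by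
  rw [← slopeTriangle_swap, ← slopeApex_swap] at hz'
  obtain ⟨ω, h1, h2, h3⟩ := exists_sub_slopeApex_eq hu hv hz
  obtain ⟨ω', h1', h2', h3'⟩ :=
    exists_sub_slopeApex_eq (by rwa [abs_neg]) (by rwa [abs_neg]) hz'
  rw [slopeApex_swap] at h1'
  have h : z - z' = (b - a) * (ω + ω') := by linear_combination h1 - h1'
  rw [h, h1, h1', norm_mul, norm_mul, norm_mul, norm_sub_rev a b]
  have := Complex.abs_re_le_norm (ω + ω')
  rw [Complex.add_re, abs_of_nonpos (by linarith)] at this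
  nlinarith [norm_nonneg (b - a)]

/-- The triangle on the shorter side at `a` stays away from `b`. -/
theorem half_le_norm_sub_right {u v : ℝ} (hu : |u| ≤ 1 / 4) (hv : |v| ≤ 1 / 4) {a b z : ℂ}
    (hz : z ∈ slopeTriangle v a (slopeApex u a b)) : ‖b - a‖ / 2 ≤ ‖z - b‖ := by
  obtain ⟨ω, h1, h2, h3⟩ := exists_sub_slopeApex_eq hu hv hz
  have h : z - b = (b - a) * (ω - 1 / 2 + u * Complex.I) := by
    rw [slopeApex] at h1; linear_combination h1
  have h4 := Complex.abs_re_le_norm (ω - 1 / 2 + u * Complex.I)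
  have h5 : (ω - 1 / 2 + u * Complex.I).re = ω.re - 1 / 2 := by simp
  rw [h5, abs_of_nonpos (by linarith)] at h4
  rw [h, norm_mul]
  nlinarith [norm_nonneg (b - a)]

theorem half_le_norm_sub_left {u v : ℝ} (hu : |u| ≤ 1 / 4) (hv : |v| ≤ 1 / 4) {a b z : ℂ}
    (hz : z ∈ slopeTriangle v (slopeApex u a b) b) : ‖b - a‖ / 2 ≤ ‖z - a‖ := by
  rw [← slopeTriangle_swap, ← slopeApex_swap] at hz
  simpa only [norm_sub_rev a b] using
    half_le_norm_sub_right (u := -u) (v := -v) (by rwa [abs_neg]) (by rwa [abs_neg]) hz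

/-- The base of a triangle meets the inner triangle on the shorter side at `a` in points of the
shorter side at `a` of this inner triangle only. -/
theorem mem_segment_of_mem_segment_left {u r : ℝ} (hu : u ≠ 0) (hr1 : r ≤ 1)
    {a b z : ℂ} (hab : a ≠ b) (hz : z ∈ slopeTriangle (-(r * u)) a (slopeApex u a b))
    (hs : z ∈ segment ℝ a b) : z ∈ segment ℝ a (slopeApex (-(r * u)) a (slopeApex u a b)) := by
  obtain ⟨x, y, w, hx, hy, hw, h1, rfl⟩ := mem_slopeTriangle_iff.1 hz
  obtain ⟨α, β, hα, hβ, hαβ, h⟩ := hs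
  have hy' : x = 1 - y - w := by linarith
  have hα' : α = 1 - β := by linarith
  have hba : b - a ≠ 0 := sub_ne_zero.2 hab.symm
  have e : ((⟨y / 2 + w * (1 / 4 + r * u ^ 2), y * u + w * (1 - r) * u / 2⟩ : ℂ)) = (β : ℂ) := by
    apply mul_left_cancel₀ hba
    subst hy' hα'
    simp only [Complex.real_smul] at h
    rw [Complex.mk_eq_add_mul_I]
    simp only [slopeApex] at h
    push_cast at h ⊢
    linear_combination (norm := (ring_nf; simp only [Complex.I_sq]; ring)) -h
  have him := congrArg Complex.im e
  simp only [Complex.ofReal_im] at him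
  have hyw : y + w * (1 - r) / 2 = 0 := by
    apply mul_right_cancel₀ hu; linear_combination him
  have hwr : 0 ≤ w * (1 - r) := mul_nonneg hw (by linarith)
  have hy0 : y = 0 := by linarith
  subst hy0
  refine ⟨x, w, hx, hw, by linarith, ?_⟩
  simp [Complex.real_smul]

theorem mem_segment_of_mem_segment_right {u r : ℝ} (hu : u ≠ 0) (hr1 : r ≤ 1)
    {a b z : ℂ} (hab : a ≠ b) (hz : z ∈ slopeTriangle (-(r * u)) (slopeApex u a b) b)
    (hs : z ∈ segment ℝ a b) : z ∈ segment ℝ (slopeApex (-(r * u)) (slopeApex u a b) b) b := by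
  rw [← slopeTriangle_swap, ← slopeApex_swap, ← mul_neg] at hz
  rw [segment_symm] at hs ⊢
  have := mem_segment_of_mem_segment_left (neg_ne_zero.2 hu) hr1 hab.symm hz hs
  rwa [slopeApex_swap u, mul_neg, slopeApex_swap] at this

/-- The ratio of the length of the shorter sides to that of the base, for an isosceles triangle
whose ratio of height to base length is `t`. -/
noncomputable def sideRatio (t : ℝ) : ℝ := √(1 + 4 * t ^ 2) / 2

theorem norm_slopeApex_sub_left (u : ℝ) (a b : ℂ) :
    ‖slopeApex u a b - a‖ = ‖b - a‖ * sideRatio u := by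
  have h : slopeApex u a b - a = (b - a) * ⟨1 / 2, u⟩ := by
    rw [Complex.mk_eq_add_mul_I, slopeApex]; push_cast; ring
  rw [h, norm_mul, sideRatio]
  congr 1
  rw [Complex.norm_def, Complex.normSq_mk]
  rw [show 1 + 4 * u ^ 2 = 2 ^ 2 * (1 / 2 * (1 / 2) + u * u) by ring,
    Real.sqrt_mul (by positivity), Real.sqrt_sq zero_le_two]
  ring

theorem norm_right_sub_slopeApex (u : ℝ) (a b : ℂ) :
    ‖b - slopeApex u a b‖ = ‖b - a‖ * sideRatio u := by
  rw [norm_sub_rev, ← slopeApex_swap, norm_slopeApex_sub_left, norm_sub_rev, sideRatio, sideRatio,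
    neg_sq]

theorem half_le_sideRatio (t : ℝ) : 1 / 2 ≤ sideRatio t := by
  rw [sideRatio]
  have : 1 ≤ √(1 + 4 * t ^ 2) := Real.one_le_sqrt.2 (by nlinarith [sq_nonneg t])
  linarith

theorem sideRatio_le {t : ℝ} (ht : |t| ≤ 1 / 4) : sideRatio t ≤ 3 / 4 := by
  have h2 : t ^ 2 ≤ 1 / 16 := by rw [← sq_abs]; nlinarith [abs_nonneg t]
  have : √(1 + 4 * t ^ 2) ≤ 3 / 2 := Real.sqrt_le_iff.2 ⟨by norm_num, by linarith⟩
  rw [sideRatio]; linarith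

theorem sideRatio_mono {t t' : ℝ} (ht : 0 ≤ t) (h : t ≤ t') : sideRatio t ≤ sideRatio t' := by
  unfold sideRatio; gcongr

theorem continuous_sideRatio : Continuous sideRatio := by unfold sideRatio; fun_prop

theorem norm_sub_left_le {u : ℝ} (hu : |u| ≤ 1 / 4) {a b z : ℂ} (hz : z ∈ slopeTriangle u a b) :
    ‖z - a‖ ≤ ‖b - a‖ := by
  have : slopeTriangle u a b ⊆ Metric.closedBall a ‖b - a‖ := by
    refine convexHull_min ?_ (convex_closedBall _ _)
    rintro z (rfl | rfl | rfl)
    · simp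
    · simp [dist_eq_norm]
    · rw [Metric.mem_closedBall, dist_eq_norm, norm_slopeApex_sub_left]
      nlinarith [norm_nonneg (b - a), sideRatio_le hu]
  simpa [dist_eq_norm] using this hz

/-! ### The triangles of one level in the order of the curve -/

/-- An antitone sequence of positive ratios of height to base length, all at most `1 / 4`. -/
structure IsSlopeSeq (t : ℕ → ℝ) : Prop where
  pos : ∀ n, 0 < t n
  le_quarter : ∀ n, t n ≤ 1 / 4
  anti : ∀ n, t (n + 1) ≤ t n

/-- The slope of the triangles of level `n`, signed for bases that are oriented along the curve:
the triangles lie alternately to the left and to the right of the curve. -/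
noncomputable def altSlope (t : ℕ → ℝ) (n : ℕ) : ℝ := (-1) ^ n * t n

/-- The vertices `curveVertex t a b n k`, `k ≤ 2 ^ n`, of the polygonal line of level `n`, in their
order along the curve from `a` to `b`. -/
noncomputable def curveVertex (t : ℕ → ℝ) (a b : ℂ) : ℕ → ℕ → ℂ
  | 0, k => if k = 0 then a else b
  | n + 1, k =>
    if k % 2 = 0 then curveVertex t a b n (k / 2)
    else slopeApex (altSlope t n) (curveVertex t a b n (k / 2)) (curveVertex t a b n (k / 2 + 1))

/-- The triangle of level `n` on the base from the `k`-th to the `k + 1`-st vertex. -/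
noncomputable def curveTile (t : ℕ → ℝ) (a b : ℂ) (n k : ℕ) : Set ℂ :=
  slopeTriangle (altSlope t n) (curveVertex t a b n k) (curveVertex t a b n (k + 1))

/-- The length of the bases of level `n`, if the first base has length `l` and the caps of level `k`
have the ratio `t k` of height to base length. -/
noncomputable def sideLength (t : ℕ → ℝ) (l : ℝ) : ℕ → ℝ
  | 0 => l
  | n + 1 => sideLength t l n * sideRatio (t n)

section Tiles

variable {t : ℕ → ℝ} {a b : ℂ} {n k : ℕ}

theorem curveVertex_even (t : ℕ → ℝ) (a b : ℂ) (n k : ℕ) :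
    curveVertex t a b (n + 1) (2 * k) = curveVertex t a b n k := by
  simp [curveVertex]

theorem curveVertex_odd (t : ℕ → ℝ) (a b : ℂ) (n k : ℕ) :
    curveVertex t a b (n + 1) (2 * k + 1) =
      slopeApex (altSlope t n) (curveVertex t a b n k) (curveVertex t a b n (k + 1)) := by
  have h1 : (2 * k + 1) % 2 = 1 := by omega
  have h2 : (2 * k + 1) / 2 = k := by omega
  simp [curveVertex, h1, h2]

theorem curveVertex_even_succ (t : ℕ → ℝ) (a b : ℂ) (n k : ℕ) :
    curveVertex t a b (n + 1) (2 * k + 1 + 1) = curveVertex t a b n (k + 1) :=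
  curveVertex_even t a b n (k + 1)

theorem curveTile_even (t : ℕ → ℝ) (a b : ℂ) (n k : ℕ) :
    curveTile t a b (n + 1) (2 * k) = slopeTriangle (altSlope t (n + 1)) (curveVertex t a b n k)
      (slopeApex (altSlope t n) (curveVertex t a b n k) (curveVertex t a b n (k + 1))) := by
  rw [curveTile, curveVertex_even, curveVertex_odd]

theorem curveTile_odd (t : ℕ → ℝ) (a b : ℂ) (n k : ℕ) :
    curveTile t a b (n + 1) (2 * k + 1) = slopeTriangle (altSlope t (n + 1))
      (slopeApex (altSlope t n) (curveVertex t a b n k) (curveVertex t a b n (k + 1)))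
      (curveVertex t a b n (k + 1)) := by
  rw [curveTile, curveVertex_even_succ, curveVertex_odd]

theorem abs_altSlope_le (ht : IsSlopeSeq t) (n : ℕ) : |altSlope t n| ≤ 1 / 4 := by
  rw [altSlope, abs_mul, abs_neg_one_pow, one_mul, abs_of_pos (ht.pos n)]
  exact ht.le_quarter n

theorem altSlope_ne_zero (ht : IsSlopeSeq t) (n : ℕ) : altSlope t n ≠ 0 :=
  mul_ne_zero (pow_ne_zero _ (by norm_num)) (ht.pos n).ne'

theorem altSlope_succ (ht : IsSlopeSeq t) (n : ℕ) :
    ∃ r : ℝ, 0 ≤ r ∧ r ≤ 1 ∧ altSlope t (n + 1) = -(r * altSlope t n) := by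
  have h := ht.pos n
  refine ⟨t (n + 1) / t n, (div_pos (ht.pos _) h).le, (div_le_one h).2 (ht.anti n), ?_⟩
  rw [altSlope, altSlope, pow_succ]
  field_simp

theorem sideRatio_altSlope (t : ℕ → ℝ) (n : ℕ) : sideRatio (altSlope t n) = sideRatio (t n) := by
  rw [sideRatio, sideRatio, altSlope, mul_pow, ← pow_mul, mul_comm n 2, pow_mul]
  simp

theorem norm_curveVertex_sub (t : ℕ → ℝ) (a b : ℂ) (n k : ℕ) (hk : k < 2 ^ n) :
    ‖curveVertex t a b n (k + 1) - curveVertex t a b n k‖ = sideLength t ‖b - a‖ n := by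
  induction n generalizing k with
  | zero =>
    obtain rfl : k = 0 := by simpa using hk
    simp [curveVertex, sideLength]
  | succ n ih =>
    have hk2 : k / 2 < 2 ^ n := by rw [pow_succ] at hk; omega
    rw [sideLength, ← ih (k / 2) hk2, ← sideRatio_altSlope]
    obtain ⟨j, rfl | rfl⟩ : ∃ j, k = 2 * j ∨ k = 2 * j + 1 := ⟨k / 2, by omega⟩
    · rw [curveVertex_even, curveVertex_odd, norm_slopeApex_sub_left,
        show 2 * j / 2 = j by omega]
    · rw [curveVertex_even_succ, curveVertex_odd, norm_right_sub_slopeApex,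
        show (2 * j + 1) / 2 = j by omega]

theorem sideLength_pos (t : ℕ → ℝ) {l : ℝ} (hl : 0 < l) (n : ℕ) : 0 < sideLength t l n := by
  induction n with
  | zero => exact hl
  | succ n ih => exact mul_pos ih (by linarith [half_le_sideRatio (t n)])

theorem sideLength_succ_le (ht : IsSlopeSeq t) {l : ℝ} (hl : 0 < l) (n : ℕ) :
    sideLength t l (n + 1) ≤ sideLength t l n := by
  have h := sideRatio_le (t := t n) (by rw [abs_of_pos (ht.pos n)]; exact ht.le_quarter n)
  rw [sideLength]
  nlinarith [sideLength_pos t hl n]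

theorem curveTile_subset (ht : IsSlopeSeq t) (a b : ℂ) (n k : ℕ) :
    curveTile t a b (n + 1) k ⊆ curveTile t a b n (k / 2) := by
  obtain ⟨r, hr0, hr1, hr⟩ := altSlope_succ ht n
  obtain ⟨j, rfl | rfl⟩ : ∃ j, k = 2 * j ∨ k = 2 * j + 1 := ⟨k / 2, by omega⟩
  · rw [curveTile_even, hr, show 2 * j / 2 = j by omega]
    exact slopeTriangle_subset_left (abs_altSlope_le ht n) hr0 hr1 _ _
  · rw [curveTile_odd, hr, show (2 * j + 1) / 2 = j by omega]
    exact slopeTriangle_subset_right (abs_altSlope_le ht n) hr0 hr1 _ _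

theorem curveVertex_mem_curveTile (t : ℕ → ℝ) (a b : ℂ) (n k : ℕ) :
    curveVertex t a b n k ∈ curveTile t a b n k := left_mem_slopeTriangle _ _ _

/-- Two neighbouring triangles lie in two cones at their common vertex, with an angle bounded
away from zero between them: this holds for the two children of a triangle, and passes on to the
neighbouring descendants of these. -/
theorem dist_neighbours (ht : IsSlopeSeq t) (hk : k + 1 < 2 ^ n) {z z' : ℂ}
    (hz : z ∈ curveTile t a b n k) (hz' : z' ∈ curveTile t a b n (k + 1)) :
    3 / 5 * (‖z - curveVertex t a b n (k + 1)‖ + ‖z' - curveVertex t a b n (k + 1)‖) ≤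
      ‖z - z'‖ := by
  induction n generalizing k with
  | zero => simp at hk
  | succ n ih =>
    obtain ⟨j, rfl | rfl⟩ : ∃ j, k = 2 * j ∨ k = 2 * j + 1 := ⟨k / 2, by omega⟩
    · rw [curveTile_even] at hz
      rw [curveTile_odd] at hz'
      rw [curveVertex_odd]
      exact dist_siblings (abs_altSlope_le ht n) (abs_altSlope_le ht (n + 1)) hz hz'
    · rw [curveVertex_even_succ]
      have hz := curveTile_subset ht a b n _ hz
      have hz' := curveTile_subset ht a b n _ hz'
      rw [show (2 * j + 1) / 2 = j by omega] at hz
      rw [show (2 * j + 1 + 1) / 2 = j + 1 by omega] at hz'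
      exact ih (by rw [pow_succ] at hk; omega) hz hz'

/-- Triangles of one level that are not neighbours have a distance comparable to their size. -/
theorem le_dist_of_not_neighbours (ht : IsSlopeSeq t) (hab : a ≠ b) {i j : ℕ} (hij : i + 2 ≤ j)
    (hj : j < 2 ^ n) {z z' : ℂ} (hz : z ∈ curveTile t a b n i) (hz' : z' ∈ curveTile t a b n j) :
    3 / 10 * sideLength t ‖b - a‖ n ≤ ‖z - z'‖ := by
  have hl : 0 < ‖b - a‖ := norm_pos_iff.2 (sub_ne_zero.2 hab.symm)
  induction n generalizing i j with
  | zero => simp at hj; omega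
  | succ n ih =>
    have hle := sideLength_succ_le ht hl n
    have pz := curveTile_subset ht a b n _ hz
    have pz' := curveTile_subset ht a b n _ hz'
    have hj2 : j / 2 < 2 ^ n := by rw [pow_succ] at hj; omega
    by_cases h : i / 2 + 2 ≤ j / 2
    · linarith [ih h hj2 pz pz']
    · -- the parents are neighbours, and one of the two triangles does not touch their common vertex
      obtain ⟨m, hm⟩ : ∃ m, i / 2 = m := ⟨_, rfl⟩
      have hjm : j / 2 = m + 1 := by omega
      rw [hm] at pz
      rw [hjm] at pz' hj2
      have key := dist_neighbours ht hj2 pz pz'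
      have far : sideLength t ‖b - a‖ n / 2 ≤ ‖z - curveVertex t a b n (m + 1)‖ ∨
          sideLength t ‖b - a‖ n / 2 ≤ ‖z' - curveVertex t a b n (m + 1)‖ := by
        obtain rfl | rfl : i = 2 * m ∨ j = 2 * (m + 1) + 1 := by omega
        · left
          rw [curveTile_even] at hz
          rw [← norm_curveVertex_sub t a b n m (by omega)]
          exact half_le_norm_sub_right (abs_altSlope_le ht n) (abs_altSlope_le ht _) hz
        · right
          rw [curveTile_odd] at hz'
          rw [← norm_curveVertex_sub t a b n (m + 1) hj2]
          exact half_le_norm_sub_left (abs_altSlope_le ht n) (abs_altSlope_le ht _) hz'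
      have n1 := norm_nonneg (z - curveVertex t a b n (m + 1))
      have n2 := norm_nonneg (z' - curveVertex t a b n (m + 1))
      rcases far with far | far <;> linarith

theorem dist_le_of_mem_curveTile (ht : IsSlopeSeq t) (hk : k < 2 ^ n) {z z' : ℂ}
    (hz : z ∈ curveTile t a b n k) (hz' : z' ∈ curveTile t a b n k) :
    dist z z' ≤ 2 * sideLength t ‖b - a‖ n := by
  have h1 := norm_sub_left_le (abs_altSlope_le ht n) hz
  have h2 := norm_sub_left_le (abs_altSlope_le ht n) hz'
  rw [norm_curveVertex_sub t a b n k hk, ← dist_eq_norm] at h1 h2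
  linarith [dist_triangle_right z z' (curveVertex t a b n k)]

/-- A point common to two triangles of one level is a vertex of that level. -/
theorem eq_curveVertex_of_mem_of_mem (ht : IsSlopeSeq t) (hab : a ≠ b) {i j : ℕ} (hij : i < j)
    (hj : j < 2 ^ n) {z : ℂ} (hz : z ∈ curveTile t a b n i) (hz' : z ∈ curveTile t a b n j) :
    z = curveVertex t a b n j := by
  have hl : 0 < ‖b - a‖ := norm_pos_iff.2 (sub_ne_zero.2 hab.symm)
  have := sideLength_pos t hl n
  by_cases h : i + 2 ≤ j
  · have := le_dist_of_not_neighbours ht hab h hj hz hz'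
    rw [sub_self, norm_zero] at this
    linarith
  · obtain rfl : j = i + 1 := by omega
    have := dist_neighbours ht hj hz hz'
    rw [sub_self, norm_zero] at this
    have h0 := norm_nonneg (z - curveVertex t a b n (i + 1))
    rw [← sub_eq_zero, ← norm_eq_zero]
    linarith

end Tiles

/-! ### The parametrization of the limit set -/

section Curve

variable {t : ℕ → ℝ} {a b : ℂ} {γ : ℝ → ℂ}

theorem floor_two_pow_succ_div (x : ℝ) (n : ℕ) : ⌊2 ^ (n + 1) * x⌋₊ / 2 = ⌊2 ^ n * x⌋₊ := by
  rw [← Nat.floor_div_ofNat, pow_succ]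
  congr 1
  ring

theorem floor_two_pow_lt {x : ℝ} (hx : x ∈ Set.Ico (0 : ℝ) 1) (n : ℕ) : ⌊2 ^ n * x⌋₊ < 2 ^ n := by
  rw [Nat.floor_lt (by have := hx.1; positivity)]
  push_cast
  nlinarith [hx.2, pow_pos (zero_lt_two (α := ℝ)) n]

/-- `γ` maps each dyadic interval of length `2 ^ (-n)` in `[0, 1)` into the corresponding triangle
of level `n`. -/
def IsLimitCurve (t : ℕ → ℝ) (a b : ℂ) (γ : ℝ → ℂ) : Prop :=
  ∀ x ∈ Set.Ico (0 : ℝ) 1, ∀ n : ℕ, γ x ∈ curveTile t a b n ⌊2 ^ n * x⌋₊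

theorem exists_isLimitCurve (ht : IsSlopeSeq t) (a b : ℂ) : ∃ γ, IsLimitCurve t a b γ := by
  have h : ∀ x : ℝ, (⋂ n : ℕ, curveTile t a b n ⌊2 ^ n * x⌋₊).Nonempty := by
    intro x
    refine IsCompact.nonempty_iInter_of_sequence_nonempty_isCompact_isClosed _ ?_ ?_ ?_ ?_
    · intro n
      have := curveTile_subset ht a b n ⌊2 ^ (n + 1) * x⌋₊
      rwa [floor_two_pow_succ_div] at this
    · exact fun n => ⟨_, curveVertex_mem_curveTile t a b n _⟩
    · exact isCompact_slopeTriangle _ _ _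
    · exact fun n => (isCompact_slopeTriangle _ _ _).isClosed
  choose γ hγ using h
  exact ⟨γ, fun x _ n => Set.mem_iInter.1 (hγ x) n⟩

theorem sub_le_of_floor_le {x y : ℝ} (hy : 0 ≤ y) (n : ℕ)
    (h : ⌊2 ^ n * x⌋₊ ≤ ⌊2 ^ n * y⌋₊ + 1) : x - y ≤ 2 / 2 ^ n := by
  have hp : (0 : ℝ) < 2 ^ n := by positivity
  have h1 := Nat.lt_floor_add_one (2 ^ n * x)
  have h2 := Nat.floor_le (mul_nonneg hp.le hy)
  have h3 : (⌊2 ^ n * x⌋₊ : ℝ) ≤ ⌊2 ^ n * y⌋₊ + 1 := by exact_mod_cast h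
  rw [le_div_iff₀ hp]
  linarith

theorem abs_sub_le_of_dist_lt (ht : IsSlopeSeq t) (hab : a ≠ b) (hγ : IsLimitCurve t a b γ)
    {x y : ℝ} (hx : x ∈ Set.Ico (0 : ℝ) 1) (hy : y ∈ Set.Ico (0 : ℝ) 1) {n : ℕ}
    (h : dist (γ x) (γ y) < 3 / 10 * sideLength t ‖b - a‖ n) : |x - y| ≤ 2 / 2 ^ n := by
  rw [abs_sub_le_iff]
  constructor
  · refine sub_le_of_floor_le hy.1 n ?_
    by_contra! hc
    have := le_dist_of_not_neighbours ht hab hc (floor_two_pow_lt hx n) (hγ y hy n) (hγ x hx n)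
    rw [norm_sub_rev (γ y), ← dist_eq_norm (γ x)] at this
    linarith
  · refine sub_le_of_floor_le hx.1 n ?_
    by_contra! hc
    have := le_dist_of_not_neighbours ht hab hc (floor_two_pow_lt hy n) (hγ x hx n) (hγ y hy n)
    rw [← dist_eq_norm (γ x)] at this
    linarith

theorem IsLimitCurve.injOn (ht : IsSlopeSeq t) (hab : a ≠ b) (hγ : IsLimitCurve t a b γ) :
    Set.InjOn γ (Set.Ico 0 1) := by
  intro x hx y hy h
  have hl : 0 < ‖b - a‖ := norm_pos_iff.2 (sub_ne_zero.2 hab.symm)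
  have key : ∀ n : ℕ, |x - y| ≤ 2 * (1 / 2) ^ n := fun n => by
    have := abs_sub_le_of_dist_lt ht hab hγ hx hy (n := n)
      (by rw [h, dist_self]; have := sideLength_pos t hl n; positivity)
    rwa [one_div_pow, mul_one_div]
  have lim : Filter.Tendsto (fun n : ℕ => 2 * (1 / 2 : ℝ) ^ n) Filter.atTop (nhds (2 * 0)) :=
    (tendsto_pow_atTop_nhds_zero_of_lt_one (by norm_num) (by norm_num)).const_mul 2
  have h0 : |x - y| ≤ 2 * 0 := ge_of_tendsto' lim key
  rw [mul_zero] at h0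
  exact sub_eq_zero.1 (abs_eq_zero.1 (le_antisymm h0 (abs_nonneg _)))

theorem pow_mul_le_sideLength {s l : ℝ} (hs : 0 ≤ s) (h : ∀ n, s ≤ sideRatio (t n)) (hl : 0 < l)
    (n : ℕ) : s ^ n * l ≤ sideLength t l n := by
  induction n with
  | zero => simp [sideLength]
  | succ n ih =>
    rw [sideLength, pow_succ]
    nlinarith [mul_le_mul ih (h n) hs (sideLength_pos t hl n).le]

/-- The inverse of the parametrization is Hölder continuous, if `s` is a lower bound of the ratios
of the side lengths of consecutive levels, and the exponent `d` is such that `s ^ d = 1 / 2`. -/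
theorem exists_abs_sub_le_rpow (ht : IsSlopeSeq t) (hab : a ≠ b) (hγ : IsLimitCurve t a b γ)
    {s d : ℝ} (hs : 0 < s) (h : ∀ n, s ≤ sideRatio (t n)) (hd : 0 < d) (hsd : s ^ d = 1 / 2) :
    ∃ C : ℝ, 0 ≤ C ∧ ∀ x ∈ Set.Ico (0 : ℝ) 1, ∀ y ∈ Set.Ico (0 : ℝ) 1,
      |x - y| ≤ C * dist (γ x) (γ y) ^ d := by
  have hl : 0 < ‖b - a‖ := norm_pos_iff.2 (sub_ne_zero.2 hab.symm)
  set l := ‖b - a‖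
  refine ⟨4 * (10 / (3 * l)) ^ d, by positivity, fun x hx y hy => ?_⟩
  by_cases hex : ∃ n : ℕ, 3 / 10 * sideLength t l n ≤ dist (γ x) (γ y)
  · classical
    -- the first level whose size is below the distance of the two points
    set n := Nat.find hex with hn
    have hle : 3 / 10 * sideLength t l n ≤ dist (γ x) (γ y) := Nat.find_spec hex
    have h1 : |x - y| ≤ 4 * (1 / 2) ^ n := by
      rcases Nat.eq_zero_or_pos n with h0 | h0
      · rw [h0, pow_zero, abs_le]
        constructor <;> linarith [hx.1, hx.2, hy.1, hy.2]
      · have hlt := Nat.find_min hex (m := n - 1) (by omega)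
        have h2 := abs_sub_le_of_dist_lt ht hab hγ hx hy (not_le.1 hlt)
        obtain ⟨m, hm⟩ : ∃ m, n = m + 1 := ⟨n - 1, by omega⟩
        rw [hm] at h2 ⊢
        rw [Nat.add_sub_cancel] at h2
        refine h2.trans_eq ?_
        rw [pow_succ, one_div_pow]
        ring
    have h3 : (1 / 2 : ℝ) ^ n = (s ^ n) ^ d := by
      rw [← hsd, ← Real.rpow_natCast, ← Real.rpow_natCast, ← Real.rpow_mul hs.le,
        ← Real.rpow_mul hs.le, mul_comm]
    have h4 : s ^ n ≤ 10 / (3 * l) * dist (γ x) (γ y) := by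
      have := pow_mul_le_sideLength hs.le h hl n
      rw [div_mul_eq_mul_div, le_div_iff₀ (by positivity)]
      linarith
    rw [mul_assoc, ← Real.mul_rpow (by positivity) dist_nonneg]
    refine h1.trans ?_
    rw [h3]
    gcongr
  · push Not at hex
    have : x = y := by
      by_contra hne
      obtain ⟨n, hn⟩ := exists_pow_lt_of_lt_one (show (0 : ℝ) < |x - y| / 2 by
        have := abs_pos.2 (sub_ne_zero.2 hne); positivity) (show (1 / 2 : ℝ) < 1 by norm_num)
      have := abs_sub_le_of_dist_lt ht hab hγ hx hy (hex n)
      rw [one_div_pow] at hn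
      rw [div_eq_mul_one_div] at this
      linarith
    rw [this, sub_self, abs_zero]
    positivity

end Curve

/-! ### The lower bound of the dimension -/

/-- The parameters in the dyadic interval of `curveTile t a b n k` whose points lie on the base of
this triangle, without being a vertex. -/
def baseParams (t : ℕ → ℝ) (a b : ℂ) (γ : ℝ → ℂ) (n k : ℕ) : Set ℝ :=
  {x | x ∈ Set.Ico (0 : ℝ) 1 ∧ ⌊2 ^ n * x⌋₊ = k ∧
    γ x ∈ segment ℝ (curveVertex t a b n k) (curveVertex t a b n (k + 1)) ∧
    ∀ m, ∀ j ≤ 2 ^ m, γ x ≠ curveVertex t a b m j}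

/-- The parameters of the points that lie on none of the bases. -/
def offParams (t : ℕ → ℝ) (a b : ℂ) (γ : ℝ → ℂ) : Set ℝ :=
  {x | x ∈ Set.Ico (0 : ℝ) 1 ∧ ∀ n, ∀ k < 2 ^ n,
    γ x ∉ segment ℝ (curveVertex t a b n k) (curveVertex t a b n (k + 1))}

section Dimension

open MeasureTheory Filter Topology
open scoped ENNReal NNReal

variable {t : ℕ → ℝ} {a b : ℂ} {γ : ℝ → ℂ}

theorem curveVertex_ne_succ (t : ℕ → ℝ) (hab : a ≠ b) {n k : ℕ} (hk : k < 2 ^ n) :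
    curveVertex t a b n k ≠ curveVertex t a b n (k + 1) := by
  have hl : 0 < ‖b - a‖ := norm_pos_iff.2 (sub_ne_zero.2 hab.symm)
  intro h
  have h1 := norm_curveVertex_sub t a b n k hk
  rw [h, sub_self, norm_zero] at h1
  exact (sideLength_pos t hl n).ne h1

/-- Of the four grandchildren of a triangle, only the first and the last can meet its base in points
that are not vertices, and they do so in points of their own bases. -/
theorem baseParams_subset (ht : IsSlopeSeq t) (hab : a ≠ b) (hγ : IsLimitCurve t a b γ) (n k : ℕ) :
    baseParams t a b γ n k ⊆
      baseParams t a b γ (n + 2) (4 * k) ∪ baseParams t a b γ (n + 2) (4 * k + 3) := by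
  rintro x ⟨hx, hk, hseg, hv⟩
  obtain ⟨r, hr0, hr1, hr⟩ := altSlope_succ ht n
  have hklt := hk ▸ floor_two_pow_lt hx n
  have hne := curveVertex_ne_succ t hab hklt
  have hlt := floor_two_pow_lt hx (n + 2)
  have h1 := floor_two_pow_succ_div x n
  have h2 := floor_two_pow_succ_div x (n + 1)
  have m1 := hγ x hx (n + 1)
  have m2 := hγ x hx (n + 2)
  rw [hk] at h1
  obtain h | h : ⌊2 ^ (n + 1) * x⌋₊ = 2 * k ∨ ⌊2 ^ (n + 1) * x⌋₊ = 2 * k + 1 := by omega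
  · left
    rw [h, curveTile_even, hr] at m1
    have hs := mem_segment_of_mem_segment_left (altSlope_ne_zero ht n) hr1 hne m1 hseg
    rw [← hr, ← curveVertex_odd, ← curveVertex_even t a b n k, ← curveVertex_odd,
      ← curveVertex_even t a b (n + 1), show 2 * (2 * k) = 4 * k by ring] at hs
    rw [show n + 1 + 1 = n + 2 from rfl] at hs h2
    obtain h' | h' : ⌊2 ^ (n + 2) * x⌋₊ = 4 * k ∨ ⌊2 ^ (n + 2) * x⌋₊ = 4 * k + 1 := by omega
    · exact ⟨hx, h', hs, hv⟩
    · rw [h'] at m2 hlt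
      exact absurd (eq_curveVertex_of_mem_of_mem ht hab (Nat.lt_succ_self _) hlt
        (segment_subset_slopeTriangle _ _ _ hs) m2) (hv _ _ hlt.le)
  · right
    rw [h, curveTile_odd, hr] at m1
    have hs := mem_segment_of_mem_segment_right (altSlope_ne_zero ht n) hr1 hne m1 hseg
    rw [← hr, ← curveVertex_odd, ← curveVertex_even_succ t a b n k, ← curveVertex_odd,
      ← curveVertex_even_succ t a b (n + 1), show 2 * (2 * k + 1) + 1 = 4 * k + 3 by ring] at hs
    rw [show n + 1 + 1 = n + 2 from rfl] at hs h2
    obtain h' | h' : ⌊2 ^ (n + 2) * x⌋₊ = 4 * k + 3 ∨ ⌊2 ^ (n + 2) * x⌋₊ = 4 * k + 2 := by omega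
    · exact ⟨hx, h', hs, hv⟩
    · have hlt' : 4 * k + 3 < 2 ^ (n + 2) := by rw [pow_add]; omega
      rw [h'] at m2
      exact absurd (eq_curveVertex_of_mem_of_mem ht hab (Nat.lt_succ_self _) hlt'
        m2 (segment_subset_slopeTriangle _ _ _ hs)) (hv _ _ hlt'.le)

theorem volume_baseParams_le (ht : IsSlopeSeq t) (hab : a ≠ b) (hγ : IsLimitCurve t a b γ)
    (m n k : ℕ) : volume (baseParams t a b γ n k) ≤ ENNReal.ofReal ((1 / 2) ^ n * (1 / 2) ^ m) := by
  induction m generalizing n k with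
  | zero =>
    have hsub : baseParams t a b γ n k ⊆ Set.Icc (k * (1 / 2) ^ n) ((k + 1) * (1 / 2) ^ n) := by
      rintro x ⟨hx, rfl, -⟩
      have hp : (0 : ℝ) < 2 ^ n := by positivity
      have h1 := Nat.lt_floor_add_one (2 ^ n * x)
      have h2 := Nat.floor_le (mul_nonneg hp.le hx.1)
      rw [Set.mem_Icc, one_div_pow, mul_one_div, mul_one_div, div_le_iff₀ hp, le_div_iff₀ hp]
      constructor <;> linarith
    refine (measure_mono hsub).trans_eq ?_
    rw [Real.volume_Icc]
    congr 1; ring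
  | succ m ih =>
    refine (measure_mono (baseParams_subset ht hab hγ n k)).trans ((measure_union_le _ _).trans
      ((add_le_add (ih _ _) (ih _ _)).trans_eq ?_))
    rw [← ENNReal.ofReal_add (by positivity) (by positivity)]
    congr 1; ring

theorem volume_baseParams (ht : IsSlopeSeq t) (hab : a ≠ b) (hγ : IsLimitCurve t a b γ)
    (n k : ℕ) : volume (baseParams t a b γ n k) = 0 := by
  have lim : Tendsto (fun m : ℕ => (1 / 2 : ℝ) ^ n * (1 / 2) ^ m) atTop (𝓝 ((1 / 2) ^ n * 0)) :=
    (tendsto_pow_atTop_nhds_zero_of_lt_one (by norm_num) (by norm_num)).const_mul _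
  have := ge_of_tendsto' (ENNReal.tendsto_ofReal lim)
    fun m => volume_baseParams_le ht hab hγ m n k
  simpa using this

/-- Almost all parameters belong to points on none of the bases. -/
theorem volume_offParams_ne_zero (ht : IsSlopeSeq t) (hab : a ≠ b) (hγ : IsLimitCurve t a b γ) :
    volume (offParams t a b γ) ≠ 0 := by
  set V : Set ℝ := ⋃ m : ℕ, ⋃ j : ℕ, {x | x ∈ Set.Ico (0 : ℝ) 1 ∧ γ x = curveVertex t a b m j}
  have hV : volume V = 0 := by
    refine Set.Countable.measure_zero (Set.countable_iUnion fun m => Set.countable_iUnion fun j => ?_) _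
    refine Set.Subsingleton.countable ?_
    rintro x ⟨hx, hx'⟩ y ⟨hy, hy'⟩
    exact hγ.injOn ht hab hx hy (hx'.trans hy'.symm)
  have hW : volume (⋃ n : ℕ, ⋃ k : ℕ, baseParams t a b γ n k) = 0 :=
    measure_iUnion_null fun n => measure_iUnion_null fun k => volume_baseParams ht hab hγ n k
  have hcover : Set.Ico (0 : ℝ) 1 ⊆
      offParams t a b γ ∪ (V ∪ ⋃ n : ℕ, ⋃ k : ℕ, baseParams t a b γ n k) := by
    intro x hx
    by_contra hcon
    simp only [Set.mem_union, not_or] at hcon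
    obtain ⟨hoff, hxV, hxW⟩ := hcon
    have hv : ∀ m j, γ x ≠ curveVertex t a b m j := fun m j h =>
      hxV (Set.mem_iUnion₂.2 ⟨m, j, hx, h⟩)
    refine hoff ⟨hx, fun n k hk hseg => ?_⟩
    have hmem := segment_subset_slopeTriangle (altSlope t n) _ _ hseg
    rcases lt_trichotomy ⌊2 ^ n * x⌋₊ k with h | h | h
    · exact hv _ _ (eq_curveVertex_of_mem_of_mem ht hab h hk (hγ x hx n) hmem)
    · exact hxW (Set.mem_iUnion₂.2 ⟨n, k, hx, h, hseg, fun m j _ => hv m j⟩)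
    · exact hv _ _ (eq_curveVertex_of_mem_of_mem ht hab h (floor_two_pow_lt hx n) hmem (hγ x hx n))
  intro h0
  have := (measure_mono (μ := volume) hcover).trans (measure_union_le _ _)
  rw [h0, zero_add] at this
  have := this.trans (measure_union_le _ _)
  rw [hV, hW, Real.volume_Ico] at this
  norm_num at this

theorem one_le_dimH_offParams (ht : IsSlopeSeq t) (hab : a ≠ b) (hγ : IsLimitCurve t a b γ) :
    1 ≤ dimH (offParams t a b γ) := by
  have := le_dimH_of_hausdorffMeasure_ne_zero (d := 1) (s := offParams t a b γ)
    (by rw [NNReal.coe_one, hausdorffMeasure_real]; exact volume_offParams_ne_zero ht hab hγ)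
  simpa using this

theorem le_dimH_image_offParams (ht : IsSlopeSeq t) (hab : a ≠ b) (hγ : IsLimitCurve t a b γ)
    {s d : ℝ} (hs : 0 < s) (h : ∀ n, s ≤ sideRatio (t n)) (hd : 0 < d) (hsd : s ^ d = 1 / 2) :
    ENNReal.ofReal d ≤ dimH (γ '' offParams t a b γ) := by
  obtain ⟨C, hC, hCle⟩ := exists_abs_sub_le_rpow ht hab hγ hs h hd hsd
  have hsub : offParams t a b γ ⊆ Set.Ico 0 1 := fun x hx => hx.1
  have hinj := hγ.injOn ht hab
  lift C to ℝ≥0 using hC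
  lift d to ℝ≥0 using hd.le
  have hH : HolderOnWith C d (Function.invFunOn γ (Set.Ico 0 1)) (γ '' offParams t a b γ) := by
    rintro _ ⟨x, hx, rfl⟩ _ ⟨y, hy, rfl⟩
    rw [hinj.leftInvOn_invFunOn (hsub hx), hinj.leftInvOn_invFunOn (hsub hy), edist_dist,
      edist_dist, ENNReal.ofReal_rpow_of_nonneg dist_nonneg d.coe_nonneg, ← ENNReal.ofReal_coe_nnreal,
      ← ENNReal.ofReal_mul C.coe_nonneg]
    exact ENNReal.ofReal_le_ofReal (hCle x (hsub hx) y (hsub hy))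
  have hd' : 0 < d := by exact_mod_cast hd
  have := hH.dimH_image_le hd'
  rw [hinj.invFunOn_image hsub] at this
  have := (one_le_dimH_offParams ht hab hγ).trans this
  rw [ENNReal.le_div_iff_mul_le (by simp [hd'.ne']) (by simp), one_mul] at this
  simpa using this

/-! ### The upper bound of the dimension -/

theorem sideLength_le_pow (ht : IsSlopeSeq t) {l : ℝ} (hl : 0 < l) (n : ℕ) :
    sideLength t l n ≤ l * (3 / 4) ^ n := by
  induction n with
  | zero => simp [sideLength]
  | succ n ih =>
    have h := sideRatio_le (t := t n) (by rw [abs_of_pos (ht.pos n)]; exact ht.le_quarter n)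
    have h0 := half_le_sideRatio (t n)
    rw [sideLength, pow_succ, ← mul_assoc]
    exact mul_le_mul ih h (by linarith) (by positivity)

theorem tendsto_sideLength (ht : IsSlopeSeq t) {l : ℝ} (hl : 0 < l) :
    Tendsto (sideLength t l) atTop (𝓝 0) := by
  have lim : Tendsto (fun n : ℕ => l * (3 / 4 : ℝ) ^ n) atTop (𝓝 (l * 0)) :=
    (tendsto_pow_atTop_nhds_zero_of_lt_one (by norm_num) (by norm_num)).const_mul l
  rw [mul_zero] at lim
  exact squeeze_zero (fun n => (sideLength_pos t hl n).le) (sideLength_le_pow ht hl) lim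

theorem tendsto_two_pow_mul_rpow {l s d : ℝ} (hl : 0 < l) (hs0 : 0 < s)
    (hs : Tendsto (fun n => sideRatio (t n)) atTop (𝓝 s)) (hsd : s ^ d < 1 / 2) :
    Tendsto (fun n => 2 ^ n * (2 * sideLength t l n) ^ d) atTop (𝓝 0) := by
  have hpos : ∀ n, 0 < 2 ^ n * (2 * sideLength t l n) ^ d := fun n => by
    have := sideLength_pos t hl n
    positivity
  refine (summable_of_ratio_test_tendsto_lt_one (l := 2 * s ^ d) (by linarith)
    (Eventually.of_forall fun n => (hpos n).ne') ?_).tendsto_atTop_zero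
  refine ((hs.rpow_const (p := d) (Or.inl hs0.ne')).const_mul 2).congr fun n => ?_
  have h1 := sideLength_pos t hl n
  have h2 : 0 < sideRatio (t n) := by linarith [half_le_sideRatio (t n)]
  have h3 : 0 < (2 * sideLength t l n) ^ d := by positivity
  rw [Real.norm_of_nonneg (hpos _).le, Real.norm_of_nonneg (hpos _).le, sideLength, ← mul_assoc,
    Real.mul_rpow (x := 2 * sideLength t l n) (by positivity) h2.le, pow_succ]
  field_simp

theorem dimH_le_of_subset_tiles (ht : IsSlopeSeq t) (hab : a ≠ b) {s d : ℝ} (hs0 : 0 < s)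
    (hs1 : s < 1) (hs : Tendsto (fun n => sideRatio (t n)) atTop (𝓝 s)) (hd : 0 < d)
    (hsd : s ^ d = 1 / 2) {S : Set ℂ}
    (hS : ∀ᶠ n in atTop, S ⊆ ⋃ k : Fin (2 ^ n), curveTile t a b n k) :
    dimH S ≤ ENNReal.ofReal d := by
  have hl : 0 < ‖b - a‖ := norm_pos_iff.2 (sub_ne_zero.2 hab.symm)
  set l := ‖b - a‖
  refine le_of_forall_gt fun c hc => ?_
  obtain ⟨e, he1, he2⟩ := ENNReal.lt_iff_exists_nnreal_btwn.1 hc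
  refine lt_of_le_of_lt (dimH_le_of_hausdorffMeasure_ne_top ?_) he2
  have hde : d < e := by
    rwa [← ENNReal.ofReal_coe_nnreal, ENNReal.ofReal_lt_ofReal_iff (hd.trans_le ?_)] at he1
    by_contra! hed
    exact absurd he1 (not_lt.2 (ENNReal.ofReal_le_ofReal hed.le))
  have hse : s ^ (e : ℝ) < 1 / 2 := hsd ▸ Real.rpow_lt_rpow_of_exponent_gt hs0 hs1 hde
  have hdiam : ∀ n (k : Fin (2 ^ n)),
      Metric.ediam (curveTile t a b n k) ≤ ENNReal.ofReal (2 * sideLength t l n) := fun n k =>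
    Metric.ediam_le fun x hx y hy => by
      rw [edist_dist]
      exact ENNReal.ofReal_le_ofReal (dist_le_of_mem_curveTile ht k.2 hx hy)
  have hzero := ENNReal.tendsto_ofReal ((tendsto_sideLength ht hl).const_mul 2)
  rw [mul_zero, ENNReal.ofReal_zero] at hzero
  have hle := Measure.hausdorffMeasure_le_liminf_sum (e : ℝ) S _ hzero
    (fun n (k : Fin (2 ^ n)) => curveTile t a b n k) (Eventually.of_forall hdiam) hS
  have hsum : ∀ n, ∑ k : Fin (2 ^ n), Metric.ediam (curveTile t a b n k) ^ (e : ℝ) ≤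
      ENNReal.ofReal (2 ^ n * (2 * sideLength t l n) ^ (e : ℝ)) := fun n => by
    have h0 : 0 ≤ 2 * sideLength t l n := by have := sideLength_pos t hl n; positivity
    refine (Finset.sum_le_sum fun k _ => ENNReal.rpow_le_rpow (hdiam n k) e.coe_nonneg).trans_eq ?_
    rw [Finset.sum_const, Finset.card_univ, Fintype.card_fin, nsmul_eq_mul,
      ENNReal.ofReal_mul (p := 2 ^ n) (by positivity),
      ENNReal.ofReal_rpow_of_nonneg h0 e.coe_nonneg,
      ENNReal.ofReal_pow zero_le_two]
    simp
  have hlim := ENNReal.tendsto_ofReal (tendsto_two_pow_mul_rpow hl hs0 hs hse)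
  rw [ENNReal.ofReal_zero] at hlim
  have hlim' := tendsto_of_tendsto_of_tendsto_of_le_of_le tendsto_const_nhds hlim
    (fun _ => zero_le) hsum
  rw [hlim'.liminf_eq] at hle
  exact ne_top_of_le_ne_top ENNReal.zero_ne_top hle

end Dimension

/-! ### The construction in the order of the curve -/

/-- The end points of the `k`-th base of level `n` along the curve, in the order used by `capBase`:
along the curve on even levels, and against it on odd levels, so that the caps always lie to the
left of their bases. -/
noncomputable def curveBase (t : ℕ → ℝ) (a b : ℂ) (n k : ℕ) : ℂ × ℂ :=
  if Even n then (curveVertex t a b n k, curveVertex t a b n (k + 1))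
  else (curveVertex t a b n (k + 1), curveVertex t a b n k)

section Koch

open Filter Topology

variable {t h : ℕ → ℝ} {a b : ℂ}

theorem capApex_eq_slopeApex {x l : ℝ} (hl : 0 < l) {p q : ℂ} (hpq : ‖q - p‖ = l) :
    capApex (x * l) p q = slopeApex x p q := by
  rw [capApex, slopeApex, hpq, mul_div_cancel_right₀ _ hl.ne']

theorem altSlope_of_even {n : ℕ} (hn : Even n) : altSlope t n = t n := by
  rw [altSlope, hn.neg_one_pow, one_mul]

theorem altSlope_of_not_even {n : ℕ} (hn : ¬Even n) : altSlope t n = -t n := by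
  rw [altSlope, (Nat.not_even_iff_odd.1 hn).neg_one_pow, neg_one_mul]

theorem norm_curveBase {n k : ℕ} (hk : k < 2 ^ n) :
    ‖(curveBase t a b n k).2 - (curveBase t a b n k).1‖ = sideLength t ‖b - a‖ n := by
  have := norm_curveVertex_sub t a b n k hk
  rw [curveBase]
  split_ifs
  · exact this
  · rwa [norm_sub_rev] at this

theorem slopeApex_curveBase (n k : ℕ) :
    slopeApex (t n) (curveBase t a b n k).1 (curveBase t a b n k).2 =
      curveVertex t a b (n + 1) (2 * k + 1) := by
  rw [curveVertex_odd, curveBase]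
  split_ifs with hn
  · rw [altSlope_of_even hn]
  · rw [altSlope_of_not_even hn, ← slopeApex_swap]

theorem slopeTriangle_curveBase (n k : ℕ) :
    slopeTriangle (t n) (curveBase t a b n k).1 (curveBase t a b n k).2 = curveTile t a b n k := by
  rw [curveTile, curveBase]
  split_ifs with hn
  · rw [altSlope_of_even hn]
  · rw [altSlope_of_not_even hn, ← slopeTriangle_swap]

theorem segment_curveBase (n k : ℕ) :
    segment ℝ (curveBase t a b n k).1 (curveBase t a b n k).2 =
      segment ℝ (curveVertex t a b n k) (curveVertex t a b n (k + 1)) := by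
  rw [curveBase]
  split_ifs with hn
  · rfl
  · exact segment_symm _ _ _

theorem capApex_curveBase (hab : a ≠ b) (hh : ∀ n, h n = t n * sideLength t ‖b - a‖ n)
    {n k : ℕ} (hk : k < 2 ^ n) :
    capApex (h n) (curveBase t a b n k).1 (curveBase t a b n k).2 =
      curveVertex t a b (n + 1) (2 * k + 1) := by
  have hl : 0 < ‖b - a‖ := norm_pos_iff.2 (sub_ne_zero.2 hab.symm)
  rw [hh n, capApex_eq_slopeApex (sideLength_pos t hl n) (norm_curveBase hk), slopeApex_curveBase]

theorem cap_curveBase (hab : a ≠ b) (hh : ∀ n, h n = t n * sideLength t ‖b - a‖ n)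
    {n k : ℕ} (hk : k < 2 ^ n) :
    cap (h n) (curveBase t a b n k).1 (curveBase t a b n k).2 = curveTile t a b n k := by
  have hl : 0 < ‖b - a‖ := norm_pos_iff.2 (sub_ne_zero.2 hab.symm)
  rw [← slopeTriangle_curveBase, cap, hh n,
    capApex_eq_slopeApex (sideLength_pos t hl n) (norm_curveBase hk), slopeTriangle]

/-- The two bases of the next level that arise from the same base are the same in both
enumerations, up to their order. -/
theorem capBase_succ_eq (hab : a ≠ b) (hh : ∀ n, h n = t n * sideLength t ‖b - a‖ n) {n i k : ℕ}
    (hk : k < 2 ^ n) (hi : capBase h a b n i = curveBase t a b n k) :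
    capBase h a b (n + 1) (2 * i) =
        curveBase t a b (n + 1) (if Even n then 2 * k else 2 * k + 1) ∧
      capBase h a b (n + 1) (2 * i + 1) =
        curveBase t a b (n + 1) (if Even n then 2 * k + 1 else 2 * k) := by
  have e1 : (2 * i + 1) / 2 = i := by omega
  have e2 : (2 * i + 1) % 2 = 1 := by omega
  have hp := capApex_curveBase hab hh hk
  simp only [capBase, e1, e2, Nat.mul_div_cancel_left i two_pos, Nat.mul_mod_right, hi, hp]
  by_cases hn : Even n <;> simp [curveBase, hn, Nat.even_add_one, curveVertex_even,
    curveVertex_even_succ]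

theorem exists_curveBase_eq (hab : a ≠ b) (hh : ∀ n, h n = t n * sideLength t ‖b - a‖ n)
    (n i : ℕ) (hi : i < 2 ^ n) : ∃ k < 2 ^ n, capBase h a b n i = curveBase t a b n k := by
  induction n generalizing i with
  | zero => exact ⟨0, by simp, by simp [capBase, curveBase, curveVertex]⟩
  | succ n ih =>
    rw [pow_succ] at hi ⊢
    obtain ⟨j, rfl | rfl⟩ : ∃ j, i = 2 * j ∨ i = 2 * j + 1 := ⟨i / 2, by omega⟩
    all_goals
      obtain ⟨k, hk, hjk⟩ := ih j (by omega)
      obtain ⟨h1, h2⟩ := capBase_succ_eq hab hh hk hjk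
    · exact ⟨_, by split_ifs <;> omega, h1⟩
    · exact ⟨_, by split_ifs <;> omega, h2⟩

theorem exists_capBase_eq (hab : a ≠ b) (hh : ∀ n, h n = t n * sideLength t ‖b - a‖ n)
    (n k : ℕ) (hk : k < 2 ^ n) : ∃ i < 2 ^ n, capBase h a b n i = curveBase t a b n k := by
  induction n generalizing k with
  | zero =>
    obtain rfl : k = 0 := by simpa using hk
    exact ⟨0, by simp, by simp [capBase, curveBase, curveVertex]⟩
  | succ n ih =>
    rw [pow_succ] at hk ⊢
    obtain ⟨j, hj⟩ : ∃ j, k = 2 * j ∨ k = 2 * j + 1 := ⟨k / 2, by omega⟩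
    obtain ⟨i, hi, hij⟩ := ih j (by omega)
    obtain ⟨h1, h2⟩ := capBase_succ_eq hab hh (by omega) hij
    by_cases hn : Even n <;> simp only [hn, if_true, if_false] at h1 h2 <;> rcases hj with rfl | rfl
    · exact ⟨_, by omega, h1⟩
    · exact ⟨_, by omega, h2⟩
    · exact ⟨_, by omega, h2⟩
    · exact ⟨_, by omega, h1⟩

theorem mem_kochStage_iff (hab : a ≠ b) (hh : ∀ n, h n = t n * sideLength t ‖b - a‖ n) {n : ℕ}
    {z : ℂ} : z ∈ kochStage h a b n ↔ ∃ k < 2 ^ n, z ∈ curveTile t a b n k := by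
  rw [kochStage, Set.mem_iUnion]
  constructor
  · rintro ⟨i, hi⟩
    obtain ⟨k, hk, hik⟩ := exists_curveBase_eq hab hh n i i.2
    rw [kochCap, hik, cap_curveBase hab hh hk] at hi
    exact ⟨k, hk, hi⟩
  · rintro ⟨k, hk, hz⟩
    obtain ⟨i, hi, hik⟩ := exists_capBase_eq hab hh n k hk
    refine ⟨⟨i, hi⟩, ?_⟩
    rwa [kochCap, hik, cap_curveBase hab hh hk]

theorem mem_kochPolygon_iff (hab : a ≠ b) (hh : ∀ n, h n = t n * sideLength t ‖b - a‖ n) {n : ℕ}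
    {z : ℂ} : z ∈ kochPolygon h a b n ↔
      ∃ k < 2 ^ n, z ∈ segment ℝ (curveVertex t a b n k) (curveVertex t a b n (k + 1)) := by
  rw [kochPolygon, Set.mem_iUnion]
  constructor
  · rintro ⟨i, hi⟩
    obtain ⟨k, hk, hik⟩ := exists_curveBase_eq hab hh n i i.2
    rw [hik, segment_curveBase] at hi
    exact ⟨k, hk, hi⟩
  · rintro ⟨k, hk, hz⟩
    obtain ⟨i, hi, hik⟩ := exists_capBase_eq hab hh n k hk
    refine ⟨⟨i, hi⟩, ?_⟩
    rwa [hik, segment_curveBase]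

theorem kochPolygon_subset_kochStage (hab : a ≠ b)
    (hh : ∀ n, h n = t n * sideLength t ‖b - a‖ n) (n : ℕ) :
    kochPolygon h a b n ⊆ kochStage h a b n := by
  intro z hz
  obtain ⟨k, hk, hz⟩ := (mem_kochPolygon_iff hab hh).1 hz
  exact (mem_kochStage_iff hab hh).2 ⟨k, hk, segment_subset_slopeTriangle _ _ _ hz⟩

theorem antitone_kochStage (ht : IsSlopeSeq t) (hab : a ≠ b)
    (hh : ∀ n, h n = t n * sideLength t ‖b - a‖ n) : Antitone (kochStage h a b) := by
  refine antitone_nat_of_succ_le fun n z hz => ?_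
  obtain ⟨k, hk, hz⟩ := (mem_kochStage_iff hab hh).1 hz
  rw [pow_succ] at hk
  exact (mem_kochStage_iff hab hh).2 ⟨k / 2, by omega, curveTile_subset ht a b n k hz⟩

theorem isClosed_kochStage (h : ℕ → ℝ) (a b : ℂ) (n : ℕ) : IsClosed (kochStage h a b n) :=
  isClosed_iUnion_of_finite fun _ => ((Set.toFinite _).isCompact_convexHull (𝕜 := ℝ)).isClosed

theorem isClosed_kochPolygon (h : ℕ → ℝ) (a b : ℂ) (n : ℕ) : IsClosed (kochPolygon h a b n) :=
  isClosed_iUnion_of_finite fun i => by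
    rw [← convexHull_pair (𝕜 := ℝ)]
    exact ((Set.toFinite _).isCompact_convexHull (𝕜 := ℝ)).isClosed

theorem closure_iUnion_diff_subset {X : Type*} [TopologicalSpace X] {P T : ℕ → Set X}
    (hP : ∀ n, IsClosed (P n)) (hT : ∀ n, IsClosed (T n)) (hPT : ∀ n, P n ⊆ T n)
    (hanti : Antitone T) (n : ℕ) : closure (⋃ m, P m) \ ⋃ m, P m ⊆ T n := by
  have hcl : IsClosed ((⋃ m ∈ Set.Iio n, P m) ∪ T n) :=
    ((Set.finite_Iio n).isClosed_biUnion fun m _ => hP m).union (hT n)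
  have hsub : closure (⋃ m, P m) ⊆ (⋃ m ∈ Set.Iio n, P m) ∪ T n := by
    refine closure_minimal (Set.iUnion_subset fun m => ?_) hcl
    rcases lt_or_ge m n with hm | hm
    · exact (Set.subset_biUnion_of_mem (u := P) (Set.mem_Iio.2 hm)).trans Set.subset_union_left
    · exact ((hPT m).trans (hanti hm)).trans Set.subset_union_right
  rintro z ⟨hz, hz'⟩
  rcases hsub hz with hz | hz
  · obtain ⟨m, -, hm⟩ := Set.mem_iUnion₂.1 hz
    exact absurd (Set.mem_iUnion.2 ⟨m, hm⟩) hz'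
  · exact hz

theorem kochEdgePoints_subset (hab : a ≠ b) (hh : ∀ n, h n = t n * sideLength t ‖b - a‖ n) :
    kochEdgePoints h a b ⊆ ⋃ n, kochPolygon h a b n := by
  intro z hz
  obtain ⟨n, hz⟩ := Set.mem_iUnion.1 hz
  obtain ⟨i, hz⟩ := Set.mem_iUnion.1 hz
  rw [Set.mem_iUnion]
  rcases hz with rfl | rfl | rfl
  · exact ⟨n, Set.mem_iUnion.2 ⟨i, left_mem_segment ℝ _ _⟩⟩
  · exact ⟨n, Set.mem_iUnion.2 ⟨i, right_mem_segment ℝ _ _⟩⟩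
  · -- the apex is a vertex of the next level
    obtain ⟨k, hk, hik⟩ := exists_curveBase_eq hab hh n i i.2
    refine ⟨n + 1, (mem_kochPolygon_iff hab hh).2 ⟨2 * k + 1, by rw [pow_succ]; omega, ?_⟩⟩
    rw [hik, capApex_curveBase hab hh hk]
    exact left_mem_segment ℝ _ _

theorem image_offParams_subset (ht : IsSlopeSeq t) (hab : a ≠ b)
    (hh : ∀ n, h n = t n * sideLength t ‖b - a‖ n) {γ : ℝ → ℂ} (hγ : IsLimitCurve t a b γ) :
    γ '' offParams t a b γ ⊆
      closure (⋃ n, kochPolygon h a b (n + 1)) \ ⋃ n, kochPolygon h a b n := by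
  have hl : 0 < ‖b - a‖ := norm_pos_iff.2 (sub_ne_zero.2 hab.symm)
  rintro _ ⟨x, ⟨hx, hoff⟩, rfl⟩
  constructor
  · refine Metric.mem_closure_iff.2 fun ε hε => ?_
    have hlim := ((tendsto_sideLength ht hl).const_mul 2).comp (tendsto_add_atTop_nat 1)
    rw [mul_zero] at hlim
    obtain ⟨n, hn⟩ := (hlim.eventually (gt_mem_nhds hε)).exists
    have hk := floor_two_pow_lt hx (n + 1)
    refine ⟨curveVertex t a b (n + 1) ⌊2 ^ (n + 1) * x⌋₊, Set.mem_iUnion.2 ⟨n,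
      (mem_kochPolygon_iff hab hh).2 ⟨_, hk, left_mem_segment ℝ _ _⟩⟩, ?_⟩
    exact (dist_le_of_mem_curveTile ht hk (hγ x hx _)
      (curveVertex_mem_curveTile t a b _ _)).trans_lt hn
  · intro hz
    obtain ⟨n, hz⟩ := Set.mem_iUnion.1 hz
    obtain ⟨k, hk, hz⟩ := (mem_kochPolygon_iff hab hh).1 hz
    exact hoff n k hk hz

theorem sideRatio_tendsto_bounds (ht : IsSlopeSeq t) {s : ℝ}
    (hs : Tendsto (fun n => sideRatio (t n)) atTop (𝓝 s)) :
    1 / 2 ≤ s ∧ s < 1 ∧ ∀ n, s ≤ sideRatio (t n) := by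
  have hanti : Antitone fun n => sideRatio (t n) :=
    antitone_nat_of_succ_le fun n => sideRatio_mono (ht.pos _).le (ht.anti n)
  refine ⟨ge_of_tendsto' hs fun n => half_le_sideRatio _, ?_, hanti.le_of_tendsto hs⟩
  have := sideRatio_le (t := t 0) (by rw [abs_of_pos (ht.pos 0)]; exact ht.le_quarter 0)
  linarith [hanti.le_of_tendsto hs 0]

/-- The dimension of every set between the limit set of the polygonal lines and the limit set of the
caps, in terms of the limit `s` of the ratios of the side lengths of consecutive levels. -/
theorem dimH_eq_of_subset_of_subset (ht : IsSlopeSeq t) (hab : a ≠ b)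
    (hh : ∀ n, h n = t n * sideLength t ‖b - a‖ n) {s : ℝ}
    (hs : Tendsto (fun n => sideRatio (t n)) atTop (𝓝 s)) {S : Set ℂ}
    (hlow : closure (⋃ n, kochPolygon h a b (n + 1)) \ ⋃ n, kochPolygon h a b n ⊆ S)
    (hup : ∀ n, S ⊆ kochStage h a b (n + 1)) :
    dimH S = ENNReal.ofReal (-(Real.log 2 / Real.log s)) := by
  obtain ⟨hs2, hs1, hsle⟩ := sideRatio_tendsto_bounds ht hs
  have hs0 : 0 < s := by linarith
  have hlog : Real.log s < 0 := Real.log_neg hs0 hs1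
  have hlog2 : 0 < Real.log 2 := Real.log_pos one_lt_two
  have hd : 0 < -(Real.log 2 / Real.log s) := neg_pos.2 (div_neg_of_pos_of_neg hlog2 hlog)
  have hsd : s ^ (-(Real.log 2 / Real.log s)) = 1 / 2 := by
    rw [Real.rpow_def_of_pos hs0, mul_neg, mul_div_cancel₀ _ hlog.ne, Real.exp_neg,
      Real.exp_log two_pos, one_div]
  refine le_antisymm ?_ ?_
  · refine dimH_le_of_subset_tiles ht hab hs0 hs1 hs hd hsd ?_
    filter_upwards [eventually_ge_atTop 1] with n hn z hz
    have hz := hup (n - 1) hz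
    rw [Nat.sub_add_cancel hn, mem_kochStage_iff hab hh] at hz
    obtain ⟨k, hk, hz⟩ := hz
    exact Set.mem_iUnion.2 ⟨⟨k, hk⟩, hz⟩
  · obtain ⟨γ, hγ⟩ := exists_isLimitCurve ht a b
    exact (le_dimH_image_offParams ht hab hγ hs0 hsle hd hsd).trans
      (dimH_mono ((image_offParams_subset ht hab hh hγ).trans hlow))

/-! ### The slopes of a construction -/

/-- The slopes of the caps `T_{n,0}` of a construction with cap heights `h`. -/
noncomputable def kochSlope (h : ℕ → ℝ) (a b : ℂ) (n : ℕ) : ℝ :=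
  h n / ‖(capBase h a b n 0).2 - (capBase h a b n 0).1‖

theorem norm_capBase_zero (h : ℕ → ℝ) (a b : ℂ) (n : ℕ) :
    ‖(capBase h a b n 0).2 - (capBase h a b n 0).1‖ = sideLength (kochSlope h a b) ‖b - a‖ n := by
  induction n with
  | zero => rfl
  | succ n ih =>
    rw [sideLength, ← ih, norm_sub_rev]
    exact norm_slopeApex_sub_left _ _ _

theorem eq_kochSlope_mul_sideLength (h : ℕ → ℝ) (hab : a ≠ b) (n : ℕ) :
    h n = kochSlope h a b n * sideLength (kochSlope h a b) ‖b - a‖ n := by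
  have hl : 0 < ‖b - a‖ := norm_pos_iff.2 (sub_ne_zero.2 hab.symm)
  have := sideLength_pos (kochSlope h a b) hl n
  rw [kochSlope, norm_capBase_zero]
  field_simp

theorem kochSlope_pos (hab : a ≠ b) {n : ℕ} (hn : 0 < h n) : 0 < kochSlope h a b n := by
  have hl : 0 < ‖b - a‖ := norm_pos_iff.2 (sub_ne_zero.2 hab.symm)
  rw [kochSlope, norm_capBase_zero]
  exact div_pos hn (sideLength_pos _ hl n)

theorem capBaseAngle_eq_arctan {x : ℝ} (hx : 0 ≤ x) {p q : ℂ} (hpq : p ≠ q) :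
    capBaseAngle x p q = Real.arctan (2 * (x / ‖q - p‖)) := by
  have hqp : q - p ≠ 0 := sub_ne_zero.2 hpq.symm
  have hu : 0 ≤ x / ‖q - p‖ := by positivity
  have hap : capApex x p q - p = (q - p) * ⟨1 / 2, x / ‖q - p‖⟩ := by
    rw [Complex.mk_eq_add_mul_I, capApex]; push_cast; ring
  have hne : (⟨1 / 2, x / ‖q - p‖⟩ : ℂ) ≠ 0 := fun h0 => by
    have := congrArg Complex.re h0
    norm_num at this
  set w : ℂ := ⟨1 / 2, x / ‖q - p‖⟩
  have h1 : |w.arg| < Real.pi / 2 := Complex.abs_arg_lt_pi_div_two_iff.2 (Or.inl (by norm_num [w]))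
  have h2 : 0 ≤ w.arg := Complex.arg_nonneg_iff.2 hu
  have h3 : Real.tan w.arg = 2 * (x / ‖q - p‖) := by
    rw [Complex.tan_arg]; simp only [w]; ring
  rw [capBaseAngle, EuclideanGeometry.angle, vsub_eq_sub, vsub_eq_sub, hap,
    Complex.angle_eq_abs_arg (mul_ne_zero hqp hne) hqp, mul_div_cancel_left₀ _ hqp,
    abs_of_nonneg h2, ← h3, Real.arctan_tan (abs_lt.1 h1).1 (abs_lt.1 h1).2]

theorem capBase_zero_ne (h : ℕ → ℝ) (hab : a ≠ b) (n : ℕ) :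
    (capBase h a b n 0).1 ≠ (capBase h a b n 0).2 := by
  have hl : 0 < ‖b - a‖ := norm_pos_iff.2 (sub_ne_zero.2 hab.symm)
  have := sideLength_pos (kochSlope h a b) hl n
  rw [← norm_capBase_zero, norm_pos_iff, sub_ne_zero] at this
  exact this.symm

section AEps

variable {θ : ℕ → ℝ}

theorem IsAEpsConstruction.angle_eq_arctan (H : IsAEpsConstruction h a b θ) (n : ℕ) :
    θ n = Real.arctan (2 * kochSlope h a b n) := by
  rw [← H.angle_eq n 0 (by positivity), kochAngle,
    capBaseAngle_eq_arctan (H.height_pos n).le (capBase_zero_ne h H.base_ne n), kochSlope]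

theorem IsAEpsConstruction.isSlopeSeq (H : IsAEpsConstruction h a b θ) :
    IsSlopeSeq (kochSlope h a b) := by
  have hl : 0 < ‖b - a‖ := norm_pos_iff.2 (sub_ne_zero.2 H.base_ne.symm)
  have hanti : ∀ n, kochSlope h a b (n + 1) ≤ kochSlope h a b n := fun n => by
    have := H.angle_le n
    rw [H.angle_eq_arctan, H.angle_eq_arctan, Real.arctan_le_arctan_iff] at this
    linarith
  have h0 : kochSlope h a b 0 ≤ 1 / 4 := by
    obtain ⟨ε, hε, he⟩ := H.height_zero
    have : kochSlope h a b 0 = ε := by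
      rw [kochSlope, norm_capBase_zero, sideLength, he, mul_div_cancel_right₀ _ hl.ne']
    linarith
  exact ⟨fun n => kochSlope_pos H.base_ne (H.height_pos n),
    fun n => (antitone_nat_of_succ_le hanti (Nat.zero_le n)).trans h0, hanti⟩

theorem IsAEpsConstruction.tendsto_sideRatio (H : IsAEpsConstruction h a b θ) {r : ℝ} (hr : 0 ≤ r)
    (hθ : Tendsto θ atTop (𝓝 r)) :
    Tendsto (fun n => sideRatio (kochSlope h a b n)) atTop
      (𝓝 ((1 / 2) * (1 + Real.tan r ^ 2) ^ (1 / 2 : ℝ))) := by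
  have hr2 : r < Real.pi / 2 := by
    have h1 : r ≤ θ 0 := (antitone_nat_of_succ_le H.angle_le).le_of_tendsto hθ 0
    rw [H.angle_eq_arctan] at h1
    exact h1.trans_lt (Real.arctan_lt_pi_div_two _)
  have hcos : Real.cos r ≠ 0 := (Real.cos_pos_of_mem_Ioo ⟨by linarith [Real.pi_pos], hr2⟩).ne'
  have hcont : ContinuousAt (fun x => √(1 + Real.tan x ^ 2) / 2) r :=
    ((((Real.continuousAt_tan.2 hcos).pow 2).const_add 1).sqrt).div_const 2
  rw [show (1 / 2) * (1 + Real.tan r ^ 2) ^ (1 / 2 : ℝ) = √(1 + Real.tan r ^ 2) / 2 by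
    rw [Real.sqrt_eq_rpow]; ring]
  refine (hcont.tendsto.comp hθ).congr fun n => ?_
  rw [Function.comp_apply, H.angle_eq_arctan, Real.tan_arctan, sideRatio, mul_pow]
  norm_num

theorem dimH_of_mem_AEpsTypeSets {r : ℝ} (hr : 0 ≤ r) {A : Set ℂ} (hA : A ∈ AEpsTypeSets r) :
    dimH A = ENNReal.ofReal
      (-(Real.log 2 / Real.log ((1 / 2) * (1 + Real.tan r ^ 2) ^ (1 / 2 : ℝ)))) := by
  obtain ⟨θ, ⟨h, a, b, H, B, hB, hAB⟩, hθ⟩ := hA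
  have ht := H.isSlopeSeq
  have hh := eq_kochSlope_mul_sideLength h H.base_ne
  have hAnti := antitone_kochStage ht H.base_ne hh
  have hpoly : kochPolygonLimit h a b ⊆ kochCapLimit h a b :=
    Set.subset_iInter (closure_iUnion_diff_subset (isClosed_kochPolygon h a b)
      (isClosed_kochStage h a b) (kochPolygon_subset_kochStage H.base_ne hh) hAnti)
  have hBup : B ⊆ kochCapLimit h a b := by rcases hB with rfl | rfl; exacts [le_rfl, hpoly]
  have hBlow : kochPolygonLimit h a b ⊆ B := by rcases hB with rfl | rfl; exacts [hpoly, le_rfl]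
  have hAup : A ⊆ kochCapLimit h a b := by
    rcases hAB with rfl | rfl
    exacts [hBup, Set.sdiff_subset.trans hBup]
  have hAlow : kochPolygonLimit h a b ⊆ A := by
    rcases hAB with rfl | rfl
    · exact hBlow
    · exact fun z hz => ⟨hBlow hz, fun hE => hz.2 (kochEdgePoints_subset H.base_ne hh hE)⟩
  refine dimH_eq_of_subset_of_subset ht H.base_ne hh (H.tendsto_sideRatio hr hθ) ?_
    fun n => hAup.trans (Set.iInter_subset _ _)
  refine Set.Subset.trans (Set.sdiff_subset_sdiff_left (closure_mono ?_)) hAlow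
  exact Set.iUnion_subset fun n => Set.subset_iUnion (kochPolygon h a b) (n + 1)

end AEps

/-! ### Heights that are halved at every level -/

section Halving

variable {ε : ℝ}

theorem kochSlope_halving_succ (ε : ℝ) (n : ℕ) :
    kochSlope (fun k => (2 : ℝ) ^ (1 - (k : ℤ)) * ε) 0 1 (n + 1) *
        (2 * sideRatio (kochSlope (fun k => (2 : ℝ) ^ (1 - (k : ℤ)) * ε) 0 1 n)) =
      kochSlope (fun k => (2 : ℝ) ^ (1 - (k : ℤ)) * ε) 0 1 n := by
  set h : ℕ → ℝ := fun k => (2 : ℝ) ^ (1 - (k : ℤ)) * ε with hdef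
  have hn := eq_kochSlope_mul_sideLength h zero_ne_one n
  have hn1 := eq_kochSlope_mul_sideLength h zero_ne_one (n + 1)
  have hpos := sideLength_pos (kochSlope h 0 1) (l := ‖(1 : ℂ) - 0‖) (by simp) n
  have hhalf : h n = 2 * h (n + 1) := by
    simp only [hdef]
    rw [show (1 : ℤ) - (n : ℕ) = (1 - ((n + 1 : ℕ) : ℤ)) + 1 by push_cast; ring,
      zpow_add₀ two_ne_zero, zpow_one]
    ring
  rw [sideLength] at hn1
  apply mul_right_cancel₀ hpos.ne'
  linear_combination hn - 2 * hn1 - hhalf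

theorem isSlopeSeq_halving (hε : 0 < ε) (hε8 : ε < 1 / 8) :
    IsSlopeSeq (kochSlope (fun k => (2 : ℝ) ^ (1 - (k : ℤ)) * ε) 0 1) := by
  have hpos : ∀ n, 0 < kochSlope (fun k => (2 : ℝ) ^ (1 - (k : ℤ)) * ε) 0 1 n :=
    fun n => kochSlope_pos zero_ne_one (by positivity)
  have hanti : ∀ n, kochSlope (fun k => (2 : ℝ) ^ (1 - (k : ℤ)) * ε) 0 1 (n + 1) ≤
      kochSlope (fun k => (2 : ℝ) ^ (1 - (k : ℤ)) * ε) 0 1 n := fun n => by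
    have h1 := kochSlope_halving_succ ε n
    have h2 := half_le_sideRatio (kochSlope (fun k => (2 : ℝ) ^ (1 - (k : ℤ)) * ε) 0 1 n)
    nlinarith [hpos (n + 1)]
  refine ⟨hpos, fun n => (antitone_nat_of_succ_le hanti (Nat.zero_le n)).trans ?_, hanti⟩
  simp only [kochSlope, capBase]
  norm_num
  linarith

theorem tendsto_kochSlope_halving (hε : 0 < ε) (hε8 : ε < 1 / 8) :
    Tendsto (kochSlope (fun k => (2 : ℝ) ^ (1 - (k : ℤ)) * ε) 0 1) atTop (𝓝 0) := by
  have ht := isSlopeSeq_halving hε hε8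
  have hrec := kochSlope_halving_succ ε
  set t := kochSlope (fun k => (2 : ℝ) ^ (1 - (k : ℤ)) * ε) 0 1
  have hlim := tendsto_atTop_ciInf (antitone_nat_of_succ_le ht.anti)
    ⟨0, by rintro _ ⟨n, rfl⟩; exact (ht.pos n).le⟩
  set τ := ⨅ n, t n
  -- the limit is a fixed point of the recursion, and `0` is the only one
  have hfix : τ * (2 * sideRatio τ) = τ := tendsto_nhds_unique
    (((hlim.comp (tendsto_add_atTop_nat 1)).mul
      (((continuous_sideRatio.tendsto τ).comp hlim).const_mul 2)).congr hrec) hlim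
  have hτ : τ = 0 := by
    by_contra hne
    have h1 : √(1 + 4 * τ ^ 2) = 1 := by
      rw [sideRatio] at hfix
      apply mul_left_cancel₀ hne
      linear_combination hfix
    rw [Real.sqrt_eq_one] at h1
    exact hne (by nlinarith)
  rwa [hτ] at hlim

theorem dimH_setAEps (hε : 0 < ε) (hε8 : ε < 1 / 8) : dimH (setAEps ε) = 1 := by
  have ht := isSlopeSeq_halving hε hε8
  have hh := eq_kochSlope_mul_sideLength (a := 0) (b := 1)
    (fun k => (2 : ℝ) ^ (1 - (k : ℤ)) * ε) zero_ne_one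
  have hs := (continuous_sideRatio.tendsto 0).comp (tendsto_kochSlope_halving hε hε8)
  have hs0 : sideRatio 0 = 1 / 2 := by simp [sideRatio]
  rw [hs0] at hs
  have hAnti := antitone_kochStage ht zero_ne_one hh
  have key := dimH_eq_of_subset_of_subset (S := setAEps ε) ht zero_ne_one hh hs
    (Set.sdiff_subset_sdiff_right (Set.iUnion_subset fun n => Set.subset_iUnion
      (kochPolygon (fun k => (2 : ℝ) ^ (1 - (k : ℤ)) * ε) 0 1) (n + 1)))
    (closure_iUnion_diff_subset (fun n => isClosed_kochPolygon _ 0 1 (n + 1))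
      (fun n => isClosed_kochStage _ 0 1 (n + 1))
      (fun n => kochPolygon_subset_kochStage zero_ne_one hh (n + 1))
      (fun m n hmn => hAnti (Nat.succ_le_succ hmn)))
  have hlog : Real.log 2 ≠ 0 := (Real.log_pos one_lt_two).ne'
  rw [key, one_div, Real.log_inv, div_neg, neg_neg, div_self hlog, ENNReal.ofReal_one]

end Halving

end Koch

/-- Every `A_ε`-type set whose base angles decrease to `r` has Hausdorff dimension
`- ln 2 / ln ((1/2) (1 + tan² r)^(1/2))`; the sets `A_ε` have Hausdorff dimension `1`. -/
theorem theorem13 :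
    (∀ r : ℝ, 0 ≤ r → ∀ A ∈ AEpsTypeSets r,
      dimH A = ENNReal.ofReal
        (-(Real.log 2 / Real.log ((1 / 2) * (1 + Real.tan r ^ 2) ^ (1 / 2 : ℝ))))) ∧
    (∀ ε : ℝ, 0 < ε → ε < 1 / 8 → dimH (setAEps ε) = 1) :=
  ⟨fun _ hr _ hA => dimH_of_mem_AEpsTypeSets hr hA, fun _ hε hε8 => dimH_setAEps hε hε8⟩
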